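/- For $n\in\mathbb N$ let $Z_n=\mathrm{diag}(z^{(n)}_1,\dots,z^{(n)}_n)$ with all $z^{(n)}_j\ge 1$, let $\hat Z_n=Z_n\oplus Z_n^{-1}\in\mathbb R^{2n\times 2n}$ and let $\lambda(n)=\frac{1}{2n}\mathrm{tr}\,\hat Z_n=\frac1{2n}\sum_{j=1}^n\bigl(z^{(n)}_j+1/z^{(n)}_j\bigr)$. Let $k_n\in\{1,\dots,n\}$ for $n\geq 1$. For $U$ in the unitary group $\mathrm U(n)$ put $$\eta(U)=\begin{pmatrix}\mathrm{Re}\,U&\mathrm{Im}\,U\\-\mathrm{Im}\,U&\mathrm{Re}\,U\end{pmatrix},\qquad J=\begin{pmatrix}0&-I_n\\I_n&0\end{pmatrix},\qquad M_{n,k}=M_{n,k}(U)=\hat\Pi_{n,k}\,\eta(U)\,\hat Z_n\,\eta(U)^T\,\hat\Pi_{n,k},$$ where $\hat\Pi_{n,k}=\Pi_{n,k}\oplus\Pi_{n,k}$ and $\Pi_{n,k}$ is the $n\times n$ diagonal matrix whose first $k$ diagonal entries are $1$ and whose other entries are $0$. **Lemma 3.1 (fourth moment).** Let $0\le\zeta<1$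 and $0\le\kappa<1$. Suppose that there are constants $C,K>0$ such that, for all large enough $n$, $\|Z_n\|_\infty\le C n^{\zeta}$ (operator norm) and $k_n\le K n^{\kappa}$, and that $\lambda(n)$ is uniformly bounded in $n$. Then, with $U$ distributed according to the normalized Haar measure on $\mathrm U(n)$ and $k=k_n$, $$\mathbb E\,\mathrm{tr}\bigl((JM_{n,k})^4\bigr)=2k_n\,\lambda(n)^4+O\bigl(n^{2\kappa+\zeta-1}\bigr)\qquad(n\to\infty).$$ -/

import Mathlib

open Filter Asymptotics MeasureTheory

noncomputable section

namespace GaussianMoments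

/-- The unitary group `U(n)`. -/
abbrev UnitaryGrp (n : ℕ) := Matrix.unitaryGroup (Fin n) ℂ

/-- Real `2n × 2n` matrices, written in blocks with respect to `(Q₁,…,Qₙ,P₁,…,Pₙ)`. -/
abbrev PhaseMatrix (n : ℕ) := Matrix (Fin n ⊕ Fin n) (Fin n ⊕ Fin n) ℝ

instance unitaryMeasurableSpace (n : ℕ) : MeasurableSpace (UnitaryGrp n) := borel _

instance unitaryBorelSpace (n : ℕ) : BorelSpace (UnitaryGrp n) := ⟨rfl⟩

instance unitaryCompactSpace (n : ℕ) : CompactSpace (UnitaryGrp n) := by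
  refine isCompact_iff_compactSpace.mp
    (?_ : IsCompact ((Matrix.unitaryGroup (Fin n) ℂ : Submonoid _) :
      Set (Matrix (Fin n) (Fin n) ℂ)))
  have hK : IsCompact (Set.univ.pi fun _ : Fin n => Set.univ.pi fun _ : Fin n =>
      Metric.closedBall (0 : ℂ) 1) :=
    isCompact_univ_pi fun _ => isCompact_univ_pi fun _ => isCompact_closedBall _ _
  refine IsCompact.of_isClosed_subset hK ?_ ?_
  · have h : ((Matrix.unitaryGroup (Fin n) ℂ : Submonoid _) : Set (Matrix (Fin n) (Fin n) ℂ))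
        = {U | star U * U = 1} ∩ {U | U * star U = 1} := by
      ext U
      exact Unitary.mem_iff
    rw [h]
    exact (isClosed_eq (by fun_prop) continuous_const).inter
      (isClosed_eq (by fun_prop) continuous_const)
  · intro U hU i _ j _
    simpa using entry_norm_bound_of_unitary hU i j

/-- The normalized Haar measure on `U(n)` (total mass one). -/
def haarU (n : ℕ) : Measure (UnitaryGrp n) := Measure.haarMeasure ⊤

instance haarUProbability (n : ℕ) : IsProbabilityMeasure (haarU n) :=
  ⟨by simpa [haarU] using Measure.haarMeasure_self (K₀ := (⊤ : TopologicalSpace.PositiveCompacts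
    (UnitaryGrp n)))⟩

/-- The isomorphism `U ↦ [[Re U, Im U], [-Im U, Re U]]` from `U(n)` onto the orthogonal symplectic
matrices. -/
def eta {n : ℕ} (U : UnitaryGrp n) : PhaseMatrix n :=
  Matrix.fromBlocks ((U : Matrix (Fin n) (Fin n) ℂ).map Complex.re)
    ((U : Matrix (Fin n) (Fin n) ℂ).map Complex.im)
    (-((U : Matrix (Fin n) (Fin n) ℂ).map Complex.im))
    ((U : Matrix (Fin n) (Fin n) ℂ).map Complex.re)

/-- `Z ⊕ Z⁻¹` with `Z = diag(z₁,…,zₙ)`: the covariance matrix of a product of one-mode squeezed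
states with squeezing parameters `z`. -/
def squeezedCov {n : ℕ} (z : Fin n → ℝ) : PhaseMatrix n :=
  Matrix.fromBlocks (Matrix.diagonal z) 0 0 (Matrix.diagonal fun j => (z j)⁻¹)

/-- `Mₙ(U) = η(U) (Z ⊕ Z⁻¹) η(U)ᵀ`. -/
def fullCov {n : ℕ} (z : Fin n → ℝ) (U : UnitaryGrp n) : PhaseMatrix n :=
  eta U * squeezedCov z * (eta U).transpose

/-- The projection `Π_{n,k} ⊕ Π_{n,k}` onto the first `k` modes, where `Π_{n,k}` is the diagonal
matrix with `k` ones followed by zeros. -/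
def modeProj (n k : ℕ) : PhaseMatrix n :=
  Matrix.fromBlocks (Matrix.diagonal fun j : Fin n => if (j : ℕ) < k then 1 else 0) 0 0
    (Matrix.diagonal fun j : Fin n => if (j : ℕ) < k then 1 else 0)

/-- `M_{n,k}(U)`: the covariance matrix of the reduced state on the first `k` modes, padded with
zeros to a `2n × 2n` matrix. -/
def reducedCov {n : ℕ} (z : Fin n → ℝ) (k : ℕ) (U : UnitaryGrp n) : PhaseMatrix n :=
  modeProj n k * fullCov z U * modeProj n k

/-- The average energy `λ(n) = tr(Z ⊕ Z⁻¹) / (2n)`. -/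
def avgEnergy {n : ℕ} (z : Fin n → ℝ) : ℝ := (squeezedCov z).trace / (2 * n)

/-- `E tr((J M_{n,k}(U))⁴)` for Haar-distributed `U`. -/
def fourthMoment {n : ℕ} (z : Fin n → ℝ) (k : ℕ) : ℝ :=
  ∫ U, ((Matrix.J (Fin n) ℝ * reducedCov z k U) ^ 4).trace ∂(haarU n)

open scoped Matrix.Norms.L2Operator in
/-- A sequence `Zₙ = diag(z₁⁽ⁿ⁾,…,zₙ⁽ⁿ⁾)` with entries at least one has bounded squeezing of degree
`ζ`: the operator norms are eventually at most `C n^ζ`. -/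
def BoundedSqueezing (ζ : ℝ) (z : ∀ n : ℕ, Fin n → ℝ) : Prop :=
  (∀ n j, 1 ≤ z n j) ∧
    ∃ C : ℝ, 0 < C ∧ ∀ᶠ n : ℕ in atTop, ‖Matrix.diagonal (z n)‖ ≤ C * (n : ℝ) ^ ζ

/-- A sequence of subsystem sizes `kₙ ∈ {1,…,n}` is bounded of degree `κ`. -/
def BoundedSubsystem (κ : ℝ) (k : ℕ → ℕ) : Prop :=
  (∀ n, 1 ≤ n → 1 ≤ k n ∧ k n ≤ n) ∧
    ∃ K : ℝ, 0 < K ∧ ∀ᶠ n : ℕ in atTop, (k n : ℝ) ≤ K * (n : ℝ) ^ κ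

/-- The random variable whose expectation is the fourth moment is integrable. -/
theorem integrable_fourth {n : ℕ} (z : Fin n → ℝ) (k : ℕ) :
    Integrable (fun U => ((Matrix.J (Fin n) ℝ * reducedCov z k U) ^ 4).trace) (haarU n) := by
  have he : Continuous (eta : UnitaryGrp n → PhaseMatrix n) := by
    have hre : Continuous fun U : UnitaryGrp n =>
        (U : Matrix (Fin n) (Fin n) ℂ).map Complex.re :=
      continuous_subtype_val.matrix_map Complex.continuous_re
    have him : Continuous fun U : UnitaryGrp n =>
        (U : Matrix (Fin n) (Fin n) ℂ).map Complex.im :=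
      continuous_subtype_val.matrix_map Complex.continuous_im
    exact hre.matrix_fromBlocks him him.neg hre
  have hc : Continuous fun U : UnitaryGrp n =>
      ((Matrix.J (Fin n) ℝ * reducedCov z k U) ^ 4).trace := by
    unfold reducedCov fullCov
    have ht := he.matrix_transpose
    exact Continuous.matrix_trace (by fun_prop)
  exact hc.integrable_of_hasCompactSupport (HasCompactSupport.of_compactSpace _)

end GaussianMoments

end

noncomputable section

namespace GaussianMoments

open ComplexConjugate

variable {n k : ℕ}

/-! ### Invariance of the random projection `U* Π U` -/

/-! Let `G = U* Π U`, a random projection of rank `k`. By cyclicity of the trace, the fourth moment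
is a sum over phase space coordinates `x, y, w, v` of `d x * d y * d w * d v`, with `d` the diagonal
of `Z ⊕ Z⁻¹`, times the mean of a cyclic product of four entries of `η(U)ᵀ J_k η(U)`
(`fourthMoment_eq_sum`). Each such entry is the imaginary part of an entry of `G` times a unit
complex number.

If the four modes are distinct, this mean is `k / (8 n⁴)` up to `O(k² / n⁵)`
(`abs_cycleMean_sub_le`). Assigning `k / (8 n⁴)` to every quadruple gives the main term exactly: `d`
has total `2nλ`, and `(2nλ)⁴ k / (8 n⁴) = 2kλ⁴`. It remains to bound the deviations (`deviation_le`,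
`sum_deviationBound_le`). With `d ≤ Z` and `λ` bounded, they add up to `O(k² Z / n)`, which has the
stated order.

No Weingarten calculus is used. The law of `G` is invariant under conjugation by unitaries, and
three kinds suffice: permutations, diagonal phases, and one unitary mixing two indices. Permutation
invariance lets a moment be averaged over a free index; summing that index with `G² = G` and `tr G =
k` reduces it to smaller moments. The recursion starts from `E G_aa² = O(k² / n²)`
(`integral_dens_sq_le`), which needs the mixing unitary. Phase averaging turns products of imaginary
parts into the real part of a cyclic product (`integral_four_im`, `integral_dens_mul_three_im`).

Coinciding modes need care with powers of `Z`. Cyclically adjacent coordinates in one mode are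
either equal, and the entry vanishes by antisymmetry, or conjugate, and their weights multiply to `z
* z⁻¹ = 1`. Hence only one factor `Z` is ever paid. -/

instance haarU_isMulRightInvariant (n : ℕ) : (haarU n).IsMulRightInvariant := by
  have : (haarU n).IsHaarMeasure := by unfold haarU; infer_instance
  -- The pushforward under right translation is again a Haar probability measure, so uniqueness
  -- identifies it with the original.
  refine ⟨fun g => ?_⟩
  have : IsProbabilityMeasure ((haarU n).map (· * g)) :=
    Measure.isProbabilityMeasure_map (by fun_prop)
  exact Measure.isHaarMeasure_eq_of_isProbabilityMeasure _ _

/-- The complex projection `U* Π_{n,k} U`. -/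
def gram {n : ℕ} (k : ℕ) (U : UnitaryGrp n) : Matrix (Fin n) (Fin n) ℂ :=
  star (U : Matrix (Fin n) (Fin n) ℂ) *
    Matrix.diagonal (fun j : Fin n => if (j : ℕ) < k then (1 : ℂ) else 0) * U

theorem continuous_gram : Continuous (gram k : UnitaryGrp n → Matrix (Fin n) (Fin n) ℂ) := by
  unfold gram
  fun_prop

@[fun_prop]
theorem continuous_gram_apply (a b : Fin n) : Continuous fun U : UnitaryGrp n => gram k U a b :=
  continuous_gram.matrix_elem a b

theorem integrable_of_continuous {f : UnitaryGrp n → ℝ} (hf : Continuous f) :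
    Integrable f (haarU n) :=
  hf.integrable_of_hasCompactSupport (HasCompactSupport.of_compactSpace _)

theorem gram_mul (U W : UnitaryGrp n) :
    gram k (U * W) = star (W : Matrix (Fin n) (Fin n) ℂ) * gram k U * W := by
  simp [gram, Matrix.mul_assoc]

theorem integral_gram_conj (W : UnitaryGrp n) (f : Matrix (Fin n) (Fin n) ℂ → ℝ) :
    ∫ U, f (star (W : Matrix (Fin n) (Fin n) ℂ) * gram k U * W) ∂haarU n
      = ∫ U, f (gram k U) ∂haarU n := by
  rw [← integral_mul_right_eq_self (fun U => f (gram k U)) W]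
  simp only [gram_mul]

theorem integral_gram_perm (σ : Equiv.Perm (Fin n)) (f : Matrix (Fin n) (Fin n) ℂ → ℝ) :
    ∫ U, f ((gram k U).submatrix σ σ) ∂haarU n = ∫ U, f (gram k U) ∂haarU n := by
  -- The inverse is needed so that conjugation relabels rows and columns by `σ` itself.
  have hW : (σ⁻¹).permMatrix ℂ ∈ Matrix.unitaryGroup (Fin n) ℂ := by
    rw [Matrix.mem_unitaryGroup_iff, Matrix.star_eq_conjTranspose, Matrix.conjTranspose_permMatrix,
      ← Matrix.permMatrix_mul]
    simp
  rw [← integral_gram_conj ⟨_, hW⟩]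
  congr 1
  ext U
  congr 1
  simp only [Matrix.star_eq_conjTranspose, Matrix.conjTranspose_permMatrix, inv_inv,
    Equiv.Perm.permMatrix, PEquiv.toMatrix_toPEquiv_mul, PEquiv.mul_toMatrix_toPEquiv]
  rfl

theorem integral_gram_phase (u : Fin n → ℂ) (hu : ∀ a, conj (u a) * u a = 1)
    (f : Matrix (Fin n) (Fin n) ℂ → ℝ) :
    ∫ U, f (Matrix.of fun a b => conj (u a) * gram k U a b * u b) ∂haarU n
      = ∫ U, f (gram k U) ∂haarU n := by
  have hW : Matrix.diagonal u ∈ Matrix.unitaryGroup (Fin n) ℂ := by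
    rw [Matrix.mem_unitaryGroup_iff', Matrix.star_eq_conjTranspose, Matrix.diagonal_conjTranspose,
      Matrix.diagonal_mul_diagonal, ← Matrix.diagonal_one]
    congr 1
    ext a
    simpa using hu a
  rw [← integral_gram_conj ⟨_, hW⟩]
  congr 1
  ext U
  congr 1
  ext a b
  simp [Matrix.star_eq_conjTranspose, Matrix.diagonal_conjTranspose, Matrix.diagonal_mul,
    Matrix.mul_diagonal]

/-- Conjugation by `(1 + iσ) / √2` with `σ` the swap of `a` and `b`; it is unitary because `σ` is a
self-adjoint involution. It relates diagonal to off-diagonal moments, which permutations and phases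
cannot do. -/
theorem integral_gram_mix (a b : Fin n) (f : Matrix (Fin n) (Fin n) ℂ → ℝ) :
    ∫ U, f (Matrix.of fun x y => (gram k U x y + gram k U (Equiv.swap a b x) (Equiv.swap a b y)
        + Complex.I * gram k U x (Equiv.swap a b y)
        - Complex.I * gram k U (Equiv.swap a b x) y) / 2) ∂haarU n
      = ∫ U, f (gram k U) ∂haarU n := by
  set σ := Equiv.swap a b with hσ
  have hs : σ⁻¹ = σ := Equiv.swap_inv a b
  have hss : σ.permMatrix ℂ * σ.permMatrix ℂ = 1 := by
    rw [← Matrix.permMatrix_mul]; simp [hσ]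
  have hc : (σ.permMatrix ℂ).conjTranspose = σ.permMatrix ℂ := by
    rw [Matrix.conjTranspose_permMatrix, hs]
  set r : ℂ := ((√2 : ℝ) : ℂ)⁻¹ with hr
  have hr2 : r * r = 1 / 2 := by
    rw [hr, ← mul_inv, ← Complex.ofReal_mul, Real.mul_self_sqrt (by norm_num)]
    norm_num
  have hrc : star r = r := by simp [hr]
  set W : Matrix (Fin n) (Fin n) ℂ := r • (1 + Complex.I • σ.permMatrix ℂ) with hWdef
  have hWs : star W = r • (1 - Complex.I • σ.permMatrix ℂ) := by
    rw [Matrix.star_eq_conjTranspose, hWdef, Matrix.conjTranspose_smul, Matrix.conjTranspose_add,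
      Matrix.conjTranspose_smul, hc, hrc]
    simp [sub_eq_add_neg]
  have hW : W ∈ Matrix.unitaryGroup (Fin n) ℂ := by
    rw [Matrix.mem_unitaryGroup_iff', hWs, hWdef, smul_mul_smul_comm, hr2]
    have : (1 - Complex.I • σ.permMatrix ℂ) * (1 + Complex.I • σ.permMatrix ℂ)
        = (2 : ℂ) • (1 : Matrix (Fin n) (Fin n) ℂ) := by
      rw [sub_mul, mul_add, mul_add, smul_mul_smul_comm, hss, Complex.I_mul_I, two_smul,
        neg_smul, one_smul, mul_one, mul_one, one_mul]
      abel
    rw [this, smul_smul]; norm_num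
  rw [← integral_gram_conj ⟨W, hW⟩]
  congr 1
  ext U
  congr 1
  rw [show star (⟨W, hW⟩ : UnitaryGrp n).1 = _ from hWs]
  ext x y
  have h1 : ∀ M : Matrix (Fin n) (Fin n) ℂ, σ.permMatrix ℂ * M = M.submatrix σ id := fun M => by
    rw [Equiv.Perm.permMatrix, PEquiv.toMatrix_toPEquiv_mul]
  have h2 : ∀ M : Matrix (Fin n) (Fin n) ℂ, M * σ.permMatrix ℂ = M.submatrix id σ := fun M => by
    rw [Equiv.Perm.permMatrix, PEquiv.mul_toMatrix_toPEquiv]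
    congr 1
  simp only [hWdef, Matrix.smul_mul, Matrix.mul_smul, sub_mul, mul_add, one_mul,
    mul_one, h1, h2, Matrix.smul_apply, Matrix.add_apply, Matrix.sub_apply, Matrix.submatrix_apply,
    id, smul_eq_mul, Matrix.of_apply]
  linear_combination (1 / 2) * gram k U (σ x) (σ y) * Complex.I_mul_I
    - (gram k U x y - Complex.I * Complex.I * gram k U (σ x) (σ y)
      + Complex.I * gram k U x (σ y) - Complex.I * gram k U (σ x) y) * hr2

/-! ### Algebraic properties of the projection -/

theorem gram_conj (U : UnitaryGrp n) (a b : Fin n) : conj (gram k U a b) = gram k U b a := by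
  have : (gram k U).conjTranspose = gram k U := by
    simp only [gram, Matrix.star_eq_conjTranspose, Matrix.conjTranspose_mul,
      Matrix.conjTranspose_conjTranspose, Matrix.diagonal_conjTranspose, Matrix.mul_assoc]
    congr 3
    ext j
    by_cases h : (j : ℕ) < k <;> simp [h]
  simpa using congrFun (congrFun this b) a

theorem gram_mul_self (U : UnitaryGrp n) : gram k U * gram k U = gram k U := by
  have h : (U : Matrix (Fin n) (Fin n) ℂ) * star (U : Matrix (Fin n) (Fin n) ℂ) = 1 :=
    Unitary.mul_star_self_of_mem U.2
  set D : Matrix (Fin n) (Fin n) ℂ := Matrix.diagonal (fun j => if (j : ℕ) < k then (1 : ℂ) else 0)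
  have hD : D * D = D := by
    simp only [D, Matrix.diagonal_mul_diagonal]
    congr 1
    ext j
    by_cases h : (j : ℕ) < k <;> simp [h]
  calc gram k U * gram k U = star (U : Matrix (Fin n) (Fin n) ℂ) * D * (U * star (U : Matrix (Fin n) (Fin n) ℂ)) * D * U := by
        simp only [gram, D, Matrix.mul_assoc]
    _ = star (U : Matrix (Fin n) (Fin n) ℂ) * (D * D) * U := by
        rw [h, Matrix.mul_one, Matrix.mul_assoc _ D D]
    _ = gram k U := by rw [hD]; rfl

theorem sum_gram_mul (U : UnitaryGrp n) (a c : Fin n) :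
    ∑ b, gram k U a b * gram k U b c = gram k U a c := by
  rw [← Matrix.mul_apply, gram_mul_self]

theorem trace_gram (hk : k ≤ n) (U : UnitaryGrp n) : ∑ a, gram k U a a = k := by
  have h : (U : Matrix (Fin n) (Fin n) ℂ) * star (U : Matrix (Fin n) (Fin n) ℂ) = 1 :=
    Unitary.mul_star_self_of_mem U.2
  have : (gram k U).trace = k := by
    rw [gram, Matrix.mul_assoc, Matrix.trace_mul_comm, Matrix.mul_assoc, h, Matrix.mul_one,
      Matrix.trace_diagonal, Finset.sum_boole, Fin.card_filter_val_lt, min_eq_right hk]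
  exact this

/-- The diagonal entries of `U* Π U`. -/
def dens (k : ℕ) (a : Fin n) (U : UnitaryGrp n) : ℝ := (gram k U a a).re

/-- The squared moduli of the entries of `U* Π U`. -/
def wt (k : ℕ) (a b : Fin n) (U : UnitaryGrp n) : ℝ := Complex.normSq (gram k U a b)

@[fun_prop]
theorem continuous_dens (a : Fin n) : Continuous (dens k a : UnitaryGrp n → ℝ) := by
  unfold dens; fun_prop

@[fun_prop]
theorem continuous_wt (a b : Fin n) : Continuous (wt k a b : UnitaryGrp n → ℝ) := by
  unfold wt
  exact Complex.continuous_normSq.comp (continuous_gram_apply a b)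

theorem gram_self (U : UnitaryGrp n) (a : Fin n) : gram k U a a = (dens k a U : ℂ) :=
  (Complex.conj_eq_iff_re.mp (gram_conj U a a)).symm

theorem gram_mul_gram_swap (U : UnitaryGrp n) (a b : Fin n) :
    gram k U a b * gram k U b a = (wt k a b U : ℂ) := by
  rw [← gram_conj U a b, Complex.mul_conj]; rfl

theorem wt_comm (a b : Fin n) (U : UnitaryGrp n) : wt k a b U = wt k b a U := by
  rw [wt, wt, ← gram_conj U a b, Complex.normSq_conj]

theorem wt_nonneg (a b : Fin n) (U : UnitaryGrp n) : 0 ≤ wt k a b U := Complex.normSq_nonneg _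

theorem wt_self (a : Fin n) (U : UnitaryGrp n) : wt k a a U = dens k a U ^ 2 := by
  rw [wt, gram_self, Complex.normSq_ofReal, sq]

theorem sum_wt (a : Fin n) (U : UnitaryGrp n) : ∑ b, wt k a b U = dens k a U := by
  have := sum_gram_mul (k := k) U a a
  simp only [gram_mul_gram_swap, gram_self] at this
  exact_mod_cast this

theorem dens_nonneg (a : Fin n) (U : UnitaryGrp n) : 0 ≤ dens k a U := by
  rw [← sum_wt]
  exact Finset.sum_nonneg fun b _ => wt_nonneg a b U

theorem dens_le_one (a : Fin n) (U : UnitaryGrp n) : dens k a U ≤ 1 := by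
  have h : dens k a U ^ 2 ≤ dens k a U := by
    rw [← wt_self]
    conv_rhs => rw [← sum_wt]
    exact Finset.single_le_sum (f := fun b => wt k a b U) (fun b _ => wt_nonneg a b U)
      (Finset.mem_univ a)
  nlinarith

theorem sum_dens (hk : k ≤ n) (U : UnitaryGrp n) : ∑ a, dens k a U = k := by
  have := trace_gram hk U
  simp only [gram_self] at this
  exact_mod_cast this

/-! ### Moments of the entries of `U* Π U` -/

/-- The form in which exchangeability is used: a moment with a free index, times the number of
admissible values, is the mean of a sum that `G² = G` or `tr G = k` evaluates. -/
theorem card_mul_integral (S : Finset (Fin n)) (g : Fin n → UnitaryGrp n → ℝ)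
    (hg : ∀ b, Continuous (g b)) {I : ℝ} (hI : ∀ b ∈ S, ∫ U, g b U ∂haarU n = I) :
    (S.card : ℝ) * I = ∫ U, ∑ b ∈ S, g b U ∂haarU n := by
  rw [integral_finsetSum _ fun b _ => integrable_of_continuous (hg b), Finset.sum_congr rfl hI]
  simp

theorem card_erase_one (a : Fin n) : ((Finset.univ.erase a).card : ℝ) = n - 1 := by
  rw [Finset.cast_card_erase_of_mem (Finset.mem_univ a)]; simp

theorem card_erase_two {a b : Fin n} (h : a ≠ b) :
    (((Finset.univ.erase a).erase b).card : ℝ) = n - 2 := by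
  rw [Finset.cast_card_erase_of_mem (by simp [h.symm]), card_erase_one]; ring

theorem card_erase_three {a b c : Fin n} (hab : a ≠ b) (hac : a ≠ c) (hbc : b ≠ c) :
    ((((Finset.univ.erase a).erase b).erase c).card : ℝ) = n - 3 := by
  rw [Finset.cast_card_erase_of_mem (by simp [hac.symm, hbc.symm]), card_erase_two hab]; ring

theorem sum_erase_one {M : Type*} [AddCommGroup M] (f : Fin n → M) (a : Fin n) :
    ∑ x ∈ Finset.univ.erase a, f x = ∑ x, f x - f a :=
  Finset.sum_erase_eq_sub (Finset.mem_univ a)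

theorem sum_erase_two {M : Type*} [AddCommGroup M] (f : Fin n → M) {a b : Fin n} (h : a ≠ b) :
    ∑ x ∈ (Finset.univ.erase a).erase b, f x = ∑ x, f x - f a - f b := by
  rw [Finset.sum_erase_eq_sub (by simp [h.symm]), sum_erase_one]

theorem sum_erase_three {M : Type*} [AddCommGroup M] (f : Fin n → M) {a b c : Fin n}
    (hab : a ≠ b) (hac : a ≠ c) (hbc : b ≠ c) :
    ∑ x ∈ ((Finset.univ.erase a).erase b).erase c, f x = ∑ x, f x - f a - f b - f c := by
  rw [Finset.sum_erase_eq_sub (by simp [hac.symm, hbc.symm]), sum_erase_two f hab]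

theorem integral_dens (hk : k ≤ n) (a : Fin n) : (n : ℝ) * ∫ U, dens k a U ∂haarU n = k := by
  have := card_mul_integral Finset.univ (fun b => dens k b) (fun b => continuous_dens b)
    (I := ∫ U, dens k a U ∂haarU n) fun b _ => by
      refine (integral_gram_perm (k := k) (Equiv.swap b a)
        (fun A => (A b b).re)).symm.trans ?_
      simp [dens]
  simpa [sum_dens hk] using this

theorem integral_dens_sq_eq (a b : Fin n) :
    ∫ U, dens k a U ^ 2 ∂haarU n = ∫ U, dens k b U ^ 2 ∂haarU n := by
  refine (integral_gram_perm (k := k) (Equiv.swap b a)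
        (fun A => (A a a).re ^ 2)).symm.trans ?_
  simp [dens]

theorem integral_dens_mul_dens (hk : k ≤ n) {a b : Fin n} (h : a ≠ b) :
    ((n : ℝ) - 1) * ∫ U, dens k a U * dens k b U ∂haarU n
      = k * (∫ U, dens k a U ∂haarU n) - ∫ U, dens k a U ^ 2 ∂haarU n := by
  have := card_mul_integral (Finset.univ.erase a) (fun b U => dens k a U * dens k b U)
    (fun b => by fun_prop) (I := ∫ U, dens k a U * dens k b U ∂haarU n) fun c hc => by
      refine (integral_gram_perm (k := k) (Equiv.swap c b)
        (fun A => (A a a).re * (A c c).re)).symm.trans ?_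
      simp [dens, Equiv.swap_apply_of_ne_of_ne (Finset.ne_of_mem_erase hc).symm h]
  rw [← card_erase_one a, this, ← integral_const_mul, ← integral_sub]
  · congr 1
    ext U
    rw [← Finset.mul_sum, sum_erase_one, sum_dens hk]
    ring
  all_goals exact integrable_of_continuous (by fun_prop)

theorem integral_wt {a b : Fin n} (h : a ≠ b) :
    ((n : ℝ) - 1) * ∫ U, wt k a b U ∂haarU n
      = (∫ U, dens k a U ∂haarU n) - ∫ U, dens k a U ^ 2 ∂haarU n := by
  have := card_mul_integral (Finset.univ.erase a) (fun b U => wt k a b U)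
    (fun b => by fun_prop) (I := ∫ U, wt k a b U ∂haarU n) fun c hc => by
      refine (integral_gram_perm (k := k) (Equiv.swap c b)
        (fun A => Complex.normSq (A a c))).symm.trans ?_
      simp [wt, Equiv.swap_apply_of_ne_of_ne (Finset.ne_of_mem_erase hc).symm h]
  rw [← card_erase_one a, this, ← integral_sub]
  · congr 1
    ext U
    rw [sum_erase_one, sum_wt, wt_self]
  all_goals exact integrable_of_continuous (by fun_prop)

/-- The phase vector with entry `w` at `a` and `1` elsewhere. -/
def phaseAt (a : Fin n) (w : ℂ) : Fin n → ℂ := Function.update 1 a w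

@[simp] theorem phaseAt_self (a : Fin n) (w : ℂ) : phaseAt a w a = w := by simp [phaseAt]

theorem phaseAt_of_ne {a b : Fin n} (h : b ≠ a) (w : ℂ) : phaseAt a w b = 1 := by
  simp [phaseAt, Function.update_of_ne h]

theorem conj_mul_phaseAt (a : Fin n) {w : ℂ} (hw : conj w * w = 1) (b : Fin n) :
    conj (phaseAt a w b) * phaseAt a w b = 1 := by
  by_cases h : b = a
  · subst h; simpa using hw
  · simp [phaseAt_of_ne h]

/-- The mixing unitary replaces `G_aa` by `(G_aa + G_bb) / 2 - Im G_ab`, and the phase `-1` at `a`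
reverses the sign of `Im G_ab`. Adding the two second moments cancels the cross term; then `(Im
G_ab)² ≤ |G_ab|²`. -/
theorem integral_dens_sq_le_add {a b : Fin n} (h : a ≠ b) :
    ∫ U, dens k a U ^ 2 ∂haarU n
      ≤ (∫ U, dens k a U * dens k b U ∂haarU n) + 2 * ∫ U, wt k a b U ∂haarU n := by
  have e1 : ∫ U, dens k a U ^ 2 ∂haarU n
      = ∫ U, ((dens k a U + dens k b U) / 2 - (gram k U a b).im) ^ 2 ∂haarU n := by
    refine (integral_gram_mix (k := k) a b (fun A => (A a a).re ^ 2)).symm.trans ?_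
    congr 1
    ext U
    simp [dens, ← gram_conj U a b]
    ring
  have e2 : ∫ U, ((dens k a U + dens k b U) / 2 - (gram k U a b).im) ^ 2 ∂haarU n
      = ∫ U, ((dens k a U + dens k b U) / 2 + (gram k U a b).im) ^ 2 ∂haarU n := by
    refine Eq.trans ?_ (integral_gram_phase (k := k) (phaseAt a (-1))
      (conj_mul_phaseAt a (by simp)) (fun A => (((A a a).re + (A b b).re) / 2 + (A a b).im) ^ 2))
    simp [dens, phaseAt_of_ne h.symm, sub_eq_add_neg]
  have e3 := integral_dens_sq_eq (k := k) a b
  have hle : (∫ U, ((dens k a U + dens k b U) / 2 - (gram k U a b).im) ^ 2 ∂haarU n)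
      + (∫ U, ((dens k a U + dens k b U) / 2 + (gram k U a b).im) ^ 2 ∂haarU n)
      ≤ ((∫ U, dens k a U ^ 2 ∂haarU n) + (∫ U, dens k b U ^ 2 ∂haarU n)) * (1 / 2)
        + (∫ U, dens k a U * dens k b U ∂haarU n) + 2 * ∫ U, wt k a b U ∂haarU n := by
    have hc : Continuous fun U : UnitaryGrp n => (gram k U a b).im :=
      Complex.continuous_im.comp (by fun_prop)
    rw [← integral_add, ← integral_add, ← integral_mul_const, ← integral_add, ← integral_const_mul,
      ← integral_add]
    · refine integral_mono (integrable_of_continuous (by fun_prop))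
        (integrable_of_continuous (by fun_prop)) fun U => ?_
      have : (gram k U a b).im ^ 2 ≤ wt k a b U := by
        rw [wt, Complex.normSq_apply]; nlinarith [sq_nonneg (gram k U a b).re]
      dsimp only
      nlinarith
    all_goals exact integrable_of_continuous (by fun_prop)
  linarith

/-- Trades the counts `n - 1` and `n - 2` of free indices for `n`, at the cost of a factor `2`. -/
theorem le_two_mul_of_mul_le {N c X Y : ℝ} (hX : 0 ≤ X) (hc : N ≤ 2 * c) (h : c * X ≤ Y) :
    N * X ≤ 2 * Y := by nlinarith

theorem integral_dens_sq_le (hn : 2 ≤ n) (hk : 1 ≤ k) (hkn : k ≤ n) (a : Fin n) :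
    (n : ℝ) ^ 2 * ∫ U, dens k a U ^ 2 ∂haarU n ≤ 6 * (k : ℝ) ^ 2 := by
  have : Nontrivial (Fin n) := Fin.nontrivial_iff_two_le.mpr hn
  obtain ⟨b, hb⟩ := exists_ne a
  have h1 := integral_dens hkn a
  have h2 := integral_dens_mul_dens hkn hb.symm
  have h3 := integral_wt (k := k) hb.symm
  have h4 := integral_dens_sq_le_add (k := k) hb.symm
  have h0 : 0 ≤ ∫ U, dens k a U ^ 2 ∂haarU n := integral_nonneg fun U => sq_nonneg _
  have he : 0 ≤ ∫ U, dens k a U ∂haarU n := integral_nonneg fun U => dens_nonneg a U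
  set A := ∫ U, dens k a U ^ 2 ∂haarU n
  set e := ∫ U, dens k a U ∂haarU n
  have hn' : (2 : ℝ) ≤ n := by exact_mod_cast hn
  have hk' : (1 : ℝ) ≤ k := by exact_mod_cast hk
  -- Inserting `h2` and `h3` into `(n - 1)` times `h4` bounds the left side by `k e + 2 e - 3 A`,
  -- and `k ≥ 1`.
  have h5 : ((n : ℝ) - 1) * A ≤ 3 * k * e := by nlinarith
  have h6 := le_two_mul_of_mul_le h0 (by linarith : (n : ℝ) ≤ 2 * (n - 1)) h5
  nlinarith

/-- Row `a` of `|G|²` sums to `G_aa`, so summing over `b` leaves at most `E G_aa²`, and one power of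
`n` is gained. -/
theorem integral_dens_mul_wt_le (hn : 2 ≤ n) (hk : 1 ≤ k) (hkn : k ≤ n) {a b : Fin n}
    (h : a ≠ b) :
    (n : ℝ) ^ 3 * ∫ U, dens k a U * wt k a b U ∂haarU n ≤ 12 * (k : ℝ) ^ 2 := by
  have hsum := card_mul_integral (Finset.univ.erase a) (fun b U => dens k a U * wt k a b U)
    (fun b => by fun_prop) (I := ∫ U, dens k a U * wt k a b U ∂haarU n) fun c hc => by
      refine (integral_gram_perm (k := k) (Equiv.swap c b)
        (fun A => (A a a).re * Complex.normSq (A a c))).symm.trans ?_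
      simp [dens, wt, Equiv.swap_apply_of_ne_of_ne (Finset.ne_of_mem_erase hc).symm h]
  rw [card_erase_one] at hsum
  have hle : ∫ U, ∑ b ∈ Finset.univ.erase a, dens k a U * wt k a b U ∂haarU n
      ≤ ∫ U, dens k a U ^ 2 ∂haarU n := by
    refine integral_mono (integrable_of_continuous (by fun_prop))
      (integrable_of_continuous (by fun_prop)) fun U => ?_
    dsimp only
    rw [← Finset.mul_sum, sum_erase_one, sum_wt, wt_self]
    nlinarith [dens_nonneg (k := k) a U, mul_nonneg (dens_nonneg (k := k) a U) (sq_nonneg (dens k a U))]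
  have hn' : (2 : ℝ) ≤ n := by exact_mod_cast hn
  have h2 := le_two_mul_of_mul_le (X := ∫ U, dens k a U * wt k a b U ∂haarU n)
    (integral_nonneg fun U => mul_nonneg (dens_nonneg a U) (wt_nonneg a b U))
    (by linarith : (n : ℝ) ≤ 2 * (n - 1)) (hsum.trans_le hle)
  have h3 := integral_dens_sq_le hn hk hkn a
  nlinarith [mul_le_mul_of_nonneg_left h2 (sq_nonneg (n : ℝ))]

theorem abs_integral_wt_sub_le (hn : 2 ≤ n) (hk : 1 ≤ k) (hkn : k ≤ n) {a b : Fin n}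
    (h : a ≠ b) :
    |(n : ℝ) ^ 3 * (∫ U, wt k a b U ∂haarU n) - n * k| ≤ 14 * (k : ℝ) ^ 2 := by
  have h1 := integral_dens hkn a
  have h2 := integral_wt (k := k) h
  have h3 := integral_dens_sq_le hn hk hkn a
  have h0 : 0 ≤ ∫ U, dens k a U ^ 2 ∂haarU n := integral_nonneg fun U => sq_nonneg _
  have hn' : (2 : ℝ) ≤ n := by exact_mod_cast hn
  have hk' : (1 : ℝ) ≤ k := by exact_mod_cast hk
  set A := ∫ U, dens k a U ^ 2 ∂haarU n
  set e := ∫ U, dens k a U ∂haarU n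
  set q := ∫ U, wt k a b U ∂haarU n
  have h4 : ((n : ℝ) - 1) * ((n : ℝ) ^ 2 * q - k) = k - (n : ℝ) ^ 2 * A := by
    linear_combination (n : ℝ) ^ 2 * h2 + n * h1
  have h5 : ((n : ℝ) - 1) * |(n : ℝ) ^ 2 * q - k| ≤ 7 * (k : ℝ) ^ 2 := by
    rw [← abs_of_nonneg (by linarith : (0 : ℝ) ≤ n - 1), ← abs_mul, h4, abs_le]
    have : 0 ≤ (n : ℝ) ^ 2 * A := by positivity
    constructor <;> nlinarith
  have h6 := le_two_mul_of_mul_le (abs_nonneg _) (by linarith : (n : ℝ) ≤ 2 * (n - 1)) h5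
  calc _ = (n : ℝ) * |(n : ℝ) ^ 2 * q - k| := by
        rw [← abs_of_nonneg (by linarith : (0 : ℝ) ≤ n), ← abs_mul, abs_of_nonneg (by linarith : (0 : ℝ) ≤ n)]
        congr 1; ring
    _ ≤ _ := by linarith

theorem integral_wt_mul_wt_le (hn : 4 ≤ n) (hk : 1 ≤ k) (hkn : k ≤ n) {a b d : Fin n}
    (hab : a ≠ b) (had : a ≠ d) (hbd : b ≠ d) :
    (n : ℝ) ^ 4 * ∫ U, wt k a b U * wt k a d U ∂haarU n ≤ 24 * (k : ℝ) ^ 2 := by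
  have hsum := card_mul_integral ((Finset.univ.erase a).erase b)
    (fun d U => wt k a b U * wt k a d U)
    (fun b => by fun_prop) (I := ∫ U, wt k a b U * wt k a d U ∂haarU n) fun c hc => by
      simp only [Finset.mem_erase, Finset.mem_univ, and_true] at hc
      refine (integral_gram_perm (k := k) (Equiv.swap c d)
        (fun A => Complex.normSq (A a b) * Complex.normSq (A a c))).symm.trans ?_
      simp [wt, Equiv.swap_apply_of_ne_of_ne hc.2.symm had,
        Equiv.swap_apply_of_ne_of_ne hc.1.symm hbd]
  rw [card_erase_two hab] at hsum
  have hle : ∫ U, ∑ d ∈ (Finset.univ.erase a).erase b, wt k a b U * wt k a d U ∂haarU n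
      ≤ ∫ U, dens k a U * wt k a b U ∂haarU n := by
    refine integral_mono (integrable_of_continuous (by fun_prop))
      (integrable_of_continuous (by fun_prop)) fun U => ?_
    dsimp only
    rw [← Finset.mul_sum, sum_erase_two _ hab, sum_wt, wt_self]
    nlinarith [wt_nonneg (k := k) a b U, mul_nonneg (wt_nonneg (k := k) a b U) (sq_nonneg (dens k a U)),
      mul_nonneg (wt_nonneg (k := k) a b U) (wt_nonneg (k := k) a b U)]
  have hn' : (4 : ℝ) ≤ n := by exact_mod_cast hn
  have h2 := le_two_mul_of_mul_le (X := ∫ U, wt k a b U * wt k a d U ∂haarU n)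
    (integral_nonneg fun U => mul_nonneg (wt_nonneg a b U) (wt_nonneg a d U))
    (by linarith : (n : ℝ) ≤ 2 * (n - 2)) (hsum.trans_le hle)
  have h3 := integral_dens_mul_wt_le (by omega) hk hkn hab
  nlinarith [mul_le_mul_of_nonneg_left h2 (by positivity : (0 : ℝ) ≤ (n : ℝ) ^ 3)]

/-- Mixing columns `b` and `d`, with a phase `w` at `d`, turns `G_ab` into `X + wY` where `|X|² =
|G_ab|² / 2` and `|Y|² = |G_ad|² / 2`. Averaging `|X + wY|⁴` over the fourth roots of unity leaves
`|X|⁴ + |Y|⁴ + 4 |X|² |Y|²`, and `E |G_ad|⁴ = E |G_ab|⁴`. -/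
theorem integral_wt_sq {a b d : Fin n} (hab : a ≠ b) (had : a ≠ d) (hbd : b ≠ d) :
    ∫ U, wt k a b U ^ 2 ∂haarU n = 2 * ∫ U, wt k a b U * wt k a d U ∂haarU n := by
  have e0 : ∫ U, wt k a b U ^ 2 ∂haarU n = ∫ U, wt k a d U ^ 2 ∂haarU n := by
    refine (integral_gram_perm (k := k) (Equiv.swap b d)
        (fun A => Complex.normSq (A a b) ^ 2)).symm.trans ?_
    simp [wt, Equiv.swap_apply_of_ne_of_ne hab had]
  have e1 : ∀ w : ℂ, conj w * w = 1 → ∫ U, wt k a b U ^ 2 ∂haarU n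
      = ∫ U, Complex.normSq (((1 - Complex.I) * gram k U a b
          + (1 + Complex.I) * (gram k U a d * w)) / 2) ^ 2 ∂haarU n := by
    intro w hw
    refine (integral_gram_mix (k := k) b d
      (fun A => Complex.normSq (A a b) ^ 2)).symm.trans ?_
    refine (integral_gram_phase (k := k) (phaseAt d w) (conj_mul_phaseAt d hw)
        (fun A => Complex.normSq (Matrix.of (fun x y => (A x y + A (Equiv.swap b d x)
          (Equiv.swap b d y) + Complex.I * A x (Equiv.swap b d y)
          - Complex.I * A (Equiv.swap b d x) y) / 2) a b) ^ 2)).symm.trans ?_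
    congr 1
    ext U
    simp only [Matrix.of_apply, Equiv.swap_apply_of_ne_of_ne hab had, Equiv.swap_apply_left,
      phaseAt_self, phaseAt_of_ne had, phaseAt_of_ne hbd, map_one, one_mul, mul_one]
    congr 3
    ring
  have hI : conj Complex.I * Complex.I = 1 := by simp
  have hc : ∀ w : ℂ, Continuous fun U : UnitaryGrp n => Complex.normSq
      (((1 - Complex.I) * gram k U a b + (1 + Complex.I) * (gram k U a d * w)) / 2) ^ 2 :=
    fun w => (Complex.continuous_normSq.comp (by fun_prop)).pow 2
  have key : (∫ U, wt k a b U ^ 2 ∂haarU n) + (∫ U, wt k a b U ^ 2 ∂haarU n)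
      + (∫ U, wt k a b U ^ 2 ∂haarU n) + (∫ U, wt k a b U ^ 2 ∂haarU n)
      = (∫ U, wt k a b U ^ 2 ∂haarU n) + (∫ U, wt k a d U ^ 2 ∂haarU n)
        + 4 * ∫ U, wt k a b U * wt k a d U ∂haarU n := by
    -- The four equal integrals are expanded with the four different roots `w`. Since `rw` hits all
    -- copies at once, the `conv` blocks fold selected copies back and expand them with the next
    -- root.
    conv_lhs => rw [e1 1 (by simp)]
    conv_lhs =>
      arg 2
      rw [← e1 1 (by simp), e1 Complex.I hI]
    conv_lhs =>
      arg 1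
      arg 2
      rw [← e1 1 (by simp), e1 (-1) (by simp)]
    conv_lhs =>
      arg 1
      arg 1
      arg 2
      rw [← e1 1 (by simp), e1 (-Complex.I) (by simp)]
    have i1 := hc 1
    have i2 := hc Complex.I
    have i3 := hc (-1)
    have i4 := hc (-Complex.I)
    rw [← integral_add, ← integral_add, ← integral_add, ← integral_add, ← integral_const_mul,
      ← integral_add]
    · congr 1
      ext U
      simp only [wt, Complex.normSq_apply]
      simp
      ring
    all_goals exact integrable_of_continuous (by fun_prop)
  linarith

theorem integral_wt_sq_le (hn : 4 ≤ n) (hk : 1 ≤ k) (hkn : k ≤ n) {a b : Fin n} (hab : a ≠ b) :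
    (n : ℝ) ^ 4 * ∫ U, wt k a b U ^ 2 ∂haarU n ≤ 48 * (k : ℝ) ^ 2 := by
  obtain ⟨d, hd⟩ : ∃ d, d ∉ ({a, b} : Finset (Fin n)) := by
    by_contra! H
    have := Finset.card_le_card (fun x _ => H x : Finset.univ ⊆ ({a, b} : Finset (Fin n)))
    have := Finset.card_le_two (a := a) (b := b)
    simp at *
    omega
  simp only [Finset.mem_insert, Finset.mem_singleton, not_or] at hd
  rw [integral_wt_sq hab (Ne.symm hd.1) (Ne.symm hd.2)]
  linarith [integral_wt_mul_wt_le hn hk hkn hab (Ne.symm hd.1) (Ne.symm hd.2)]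

/-! ### Cyclic products of entries of `U* Π U` -/

@[fun_prop]
theorem continuous_re_comp {f : UnitaryGrp n → ℂ} (hf : Continuous f) :
    Continuous fun U => (f U).re := Complex.continuous_re.comp hf

@[fun_prop]
theorem continuous_im_comp {f : UnitaryGrp n → ℂ} (hf : Continuous f) :
    Continuous fun U => (f U).im := Complex.continuous_im.comp hf

theorem abs_one_sub_dens_sub_dens_le (a b : Fin n) (U : UnitaryGrp n) :
    |1 - dens k a U - dens k b U| ≤ 1 := by
  have := dens_nonneg (k := k) a U
  have := dens_nonneg (k := k) b U
  have := dens_le_one (k := k) a U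
  have := dens_le_one (k := k) b U
  rw [abs_le]; constructor <;> linarith

theorem sum_erase_two_gram_mul (U : UnitaryGrp n) {a d : Fin n} (had : a ≠ d) (z : ℂ) :
    ∑ c ∈ (Finset.univ.erase a).erase d, z * (gram k U a c * gram k U c d)
      = z * gram k U a d * (1 - dens k a U - dens k d U) := by
  rw [← Finset.mul_sum, sum_erase_two _ had, sum_gram_mul, gram_self, gram_self]
  ring

/-- Summing over `c` collapses the cycle to `|G_ad|² (1 - G_aa - G_dd)`, whose last factor is at
most `1` in modulus. Summing before taking absolute values keeps the cancellation. -/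
theorem abs_integral_dens_mul_cycle_le (hn : 4 ≤ n) (hk : 1 ≤ k) (hkn : k ≤ n) {a c d : Fin n}
    (hac : a ≠ c) (had : a ≠ d) (hcd : c ≠ d) {w : ℂ} (hw : ‖w‖ ≤ 1) :
    (n : ℝ) ^ 4 * |∫ U, dens k a U * (w * (gram k U a c * gram k U c d * gram k U d a)).re ∂haarU n|
      ≤ 24 * (k : ℝ) ^ 2 := by
  set X := ∫ U, dens k a U * (w * (gram k U a c * gram k U c d * gram k U d a)).re ∂haarU n with hX
  have hsum := card_mul_integral ((Finset.univ.erase a).erase d)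
    (fun c U => dens k a U * (w * (gram k U a c * gram k U c d * gram k U d a)).re)
    (fun b => by fun_prop) (I := X) fun b hb => by
      simp only [Finset.mem_erase, Finset.mem_univ, and_true] at hb
      refine (integral_gram_perm (k := k) (Equiv.swap b c)
        (fun A => (A a a).re * (w * (A a b * A b d * A d a)).re)).symm.trans ?_
      simp only [Matrix.submatrix_apply, Equiv.swap_apply_left,
        Equiv.swap_apply_of_ne_of_ne hb.2.symm hac, Equiv.swap_apply_of_ne_of_ne hb.1.symm hcd.symm]
      rfl
  rw [card_erase_two had] at hsum
  have hle : |∫ U, ∑ c ∈ (Finset.univ.erase a).erase d,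
      dens k a U * (w * (gram k U a c * gram k U c d * gram k U d a)).re ∂haarU n|
      ≤ ∫ U, dens k a U * wt k a d U ∂haarU n := by
    refine abs_integral_le_integral_abs.trans (integral_mono
      (integrable_of_continuous (Continuous.abs (by fun_prop)))
      (integrable_of_continuous (by fun_prop)) fun U => ?_)
    have : ∑ c ∈ (Finset.univ.erase a).erase d,
        dens k a U * (w * (gram k U a c * gram k U c d * gram k U d a)).re
        = dens k a U * (w.re * wt k a d U * (1 - dens k a U - dens k d U)) := by
      rw [← Finset.mul_sum, ← Complex.re_sum]
      congr 1
      rw [← Complex.re_mul_ofReal, ← Complex.re_mul_ofReal]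
      congr 1
      push_cast
      rw [← gram_mul_gram_swap]
      calc _ = ∑ c ∈ (Finset.univ.erase a).erase d,
            (w * gram k U d a) * (gram k U a c * gram k U c d) :=
            Finset.sum_congr rfl fun _ _ => by ring
        _ = _ := by rw [sum_erase_two_gram_mul U had]; ring
    dsimp only
    rw [this, abs_mul, abs_mul, abs_mul, abs_of_nonneg (dens_nonneg a U),
      abs_of_nonneg (wt_nonneg a d U)]
    have h1 : |w.re| ≤ 1 := (Complex.abs_re_le_norm w).trans hw
    have h2 := abs_one_sub_dens_sub_dens_le (k := k) a d U
    refine mul_le_mul_of_nonneg_left ?_ (dens_nonneg a U)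
    calc |w.re| * wt k a d U * |1 - dens k a U - dens k d U| ≤ 1 * wt k a d U * 1 := by
          have := wt_nonneg (k := k) a d U
          gcongr
      _ = _ := by ring
  have hn' : (4 : ℝ) ≤ n := by exact_mod_cast hn
  rw [← hsum, abs_mul, abs_of_nonneg (by linarith)] at hle
  have h2 := le_two_mul_of_mul_le (abs_nonneg X) (by linarith : (n : ℝ) ≤ 2 * (n - 2)) hle
  have h3 := integral_dens_mul_wt_le (by omega) hk hkn had
  nlinarith [mul_le_mul_of_nonneg_left h2 (by positivity : (0 : ℝ) ≤ (n : ℝ) ^ 3)]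

/-- Summing the middle index gives `E |G_ad|²`, of leading order `k / n²`, minus the two terms where
that index would equal `a` or `d`. -/
theorem abs_integral_three_cycle_sub_le (hn : 4 ≤ n) (hk : 1 ≤ k) (hkn : k ≤ n) {a b d : Fin n}
    (hab : a ≠ b) (had : a ≠ d) (hbd : b ≠ d) :
    |(n : ℝ) ^ 4 * (∫ U, (gram k U a b * gram k U b d * gram k U d a).re ∂haarU n) - n * k|
      ≤ 80 * (k : ℝ) ^ 2 := by
  set X := ∫ U, (gram k U a b * gram k U b d * gram k U d a).re ∂haarU n with hX
  have hsum := card_mul_integral ((Finset.univ.erase a).erase d)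
    (fun c U => (gram k U a c * gram k U c d * gram k U d a).re)
    (fun b => by fun_prop) (I := X) fun c hc => by
      simp only [Finset.mem_erase, Finset.mem_univ, and_true] at hc
      refine (integral_gram_perm (k := k) (Equiv.swap c b)
        (fun A => (A a c * A c d * A d a).re)).symm.trans ?_
      simp only [Matrix.submatrix_apply, Equiv.swap_apply_left,
        Equiv.swap_apply_of_ne_of_ne hc.2.symm hab, Equiv.swap_apply_of_ne_of_ne hc.1.symm hbd.symm]
      rfl
  rw [card_erase_two had] at hsum
  have hval : ∫ U, ∑ c ∈ (Finset.univ.erase a).erase d,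
      (gram k U a c * gram k U c d * gram k U d a).re ∂haarU n
      = (∫ U, wt k a d U ∂haarU n) - (∫ U, dens k a U * wt k a d U ∂haarU n)
        - ∫ U, dens k d U * wt k d a U ∂haarU n := by
    rw [← integral_sub, ← integral_sub]
    · congr 1
      ext U
      have h : ∑ c ∈ (Finset.univ.erase a).erase d,
          gram k U a c * gram k U c d * gram k U d a
          = ((wt k a d U * (1 - dens k a U - dens k d U) : ℝ) : ℂ) := by
        push_cast
        rw [← gram_mul_gram_swap]
        calc _ = ∑ c ∈ (Finset.univ.erase a).erase d,
              gram k U d a * (gram k U a c * gram k U c d) :=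
              Finset.sum_congr rfl fun _ _ => by ring
          _ = _ := by rw [sum_erase_two_gram_mul U had]; ring
      rw [← Complex.re_sum, h, Complex.ofReal_re, wt_comm d a]
      ring
    all_goals exact integrable_of_continuous (by fun_prop)
  have h1 := abs_integral_wt_sub_le (by omega) hk hkn had
  have h2 := integral_dens_mul_wt_le (by omega) hk hkn had
  have h3 := integral_dens_mul_wt_le (by omega) hk hkn had.symm
  have h2' : 0 ≤ ∫ U, dens k a U * wt k a d U ∂haarU n :=
    integral_nonneg fun U => mul_nonneg (dens_nonneg _ U) (wt_nonneg _ _ U)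
  have h3' : 0 ≤ ∫ U, dens k d U * wt k d a U ∂haarU n :=
    integral_nonneg fun U => mul_nonneg (dens_nonneg _ U) (wt_nonneg _ _ U)
  rw [hval] at hsum
  set q := ∫ U, wt k a d U ∂haarU n
  set s := ∫ U, dens k a U * wt k a d U ∂haarU n
  set t := ∫ U, dens k d U * wt k d a U ∂haarU n
  have hn' : (4 : ℝ) ≤ n := by exact_mod_cast hn
  have hk' : (1 : ℝ) ≤ k := by exact_mod_cast hk
  have h4 : ((n : ℝ) - 2) * ((n : ℝ) ^ 3 * X - k)
      = ((n : ℝ) ^ 3 * q - n * k) - (n : ℝ) ^ 3 * s - (n : ℝ) ^ 3 * t + 2 * k := by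
    linear_combination (n : ℝ) ^ 3 * hsum
  have h5 : ((n : ℝ) - 2) * |(n : ℝ) ^ 3 * X - k| ≤ 40 * (k : ℝ) ^ 2 := by
    rw [← abs_of_nonneg (by linarith : (0 : ℝ) ≤ n - 2), ← abs_mul, h4, abs_le]
    rw [abs_le] at h1
    have : 0 ≤ (n : ℝ) ^ 3 * s := by positivity
    have : 0 ≤ (n : ℝ) ^ 3 * t := by positivity
    constructor <;> nlinarith
  have h6 := le_two_mul_of_mul_le (abs_nonneg _) (by linarith : (n : ℝ) ≤ 2 * (n - 2)) h5
  calc _ = (n : ℝ) * |(n : ℝ) ^ 3 * X - k| := by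
        rw [← abs_of_nonneg (by linarith : (0 : ℝ) ≤ n), ← abs_mul,
          abs_of_nonneg (by linarith : (0 : ℝ) ≤ n)]
        congr 1; ring
    _ ≤ _ := by linarith

theorem abs_integral_four_cycle_sub_le (hn : 4 ≤ n) (hk : 1 ≤ k) (hkn : k ≤ n)
    {a b c d : Fin n} (hab : a ≠ b) (hac : a ≠ c) (had : a ≠ d) (hbc : b ≠ c) (hbd : b ≠ d)
    (hcd : c ≠ d) :
    |(n : ℝ) ^ 5 * (∫ U, (gram k U a b * gram k U b c * gram k U c d * gram k U d a).re ∂haarU n)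
      - n * k| ≤ 620 * (k : ℝ) ^ 2 := by
  set X := ∫ U, (gram k U a b * gram k U b c * gram k U c d * gram k U d a).re ∂haarU n with hX
  have hsum := card_mul_integral (((Finset.univ.erase a).erase b).erase d)
    (fun c U => (gram k U a b * gram k U b c * gram k U c d * gram k U d a).re)
    (fun b => by fun_prop) (I := X) fun e he => by
      simp only [Finset.mem_erase, Finset.mem_univ, and_true] at he
      refine (integral_gram_perm (k := k) (Equiv.swap e c)
        (fun A => (A a b * A b e * A e d * A d a).re)).symm.trans ?_
      simp only [Matrix.submatrix_apply, Equiv.swap_apply_left,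
        Equiv.swap_apply_of_ne_of_ne he.2.2.symm hac, Equiv.swap_apply_of_ne_of_ne he.2.1.symm hbc,
        Equiv.swap_apply_of_ne_of_ne he.1.symm hcd.symm]
      rfl
  rw [card_erase_three hab had hbd] at hsum
  -- The full sum over `c` is a three-cycle. The excluded values `c = a`, `c = b` and `c = d` give
  -- the three corrections, each `O(k² / n⁴)`.
  have hval : ∫ U, ∑ c ∈ ((Finset.univ.erase a).erase b).erase d,
      (gram k U a b * gram k U b c * gram k U c d * gram k U d a).re ∂haarU n
      = (∫ U, (gram k U a b * gram k U b d * gram k U d a).re ∂haarU n)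
        - (∫ U, wt k a b U * wt k a d U ∂haarU n)
        - (∫ U, dens k b U * (1 * (gram k U b d * gram k U d a * gram k U a b)).re ∂haarU n)
        - ∫ U, dens k d U * (1 * (gram k U d a * gram k U a b * gram k U b d)).re ∂haarU n := by
    rw [← integral_sub, ← integral_sub, ← integral_sub]
    · congr 1
      ext U
      have h : ∑ c ∈ ((Finset.univ.erase a).erase b).erase d,
          gram k U a b * gram k U b c * gram k U c d * gram k U d a
          = gram k U a b * gram k U b d * gram k U d a - ((wt k a b U * wt k a d U : ℝ) : ℂ)
            - dens k b U * (1 * (gram k U b d * gram k U d a * gram k U a b))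
            - dens k d U * (1 * (gram k U d a * gram k U a b * gram k U b d)) := by
        push_cast
        rw [← gram_mul_gram_swap, ← gram_mul_gram_swap, ← gram_self, ← gram_self]
        calc _ = ∑ c ∈ ((Finset.univ.erase a).erase b).erase d,
              (gram k U a b * gram k U d a) * (gram k U b c * gram k U c d) :=
              Finset.sum_congr rfl fun _ _ => by ring
          _ = _ := by
              rw [← Finset.mul_sum, sum_erase_three _ hab had hbd, sum_gram_mul]; ring
      rw [← Complex.re_sum, h, Complex.sub_re, Complex.sub_re, Complex.sub_re, Complex.ofReal_re,
        Complex.re_ofReal_mul, Complex.re_ofReal_mul]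
    all_goals exact integrable_of_continuous (by fun_prop)
  have h1 := abs_integral_three_cycle_sub_le hn hk hkn hab had hbd
  have h2 := integral_wt_mul_wt_le hn hk hkn hab had hbd
  have h3 := abs_integral_dens_mul_cycle_le hn hk hkn hbd hab.symm had.symm (w := 1) (by simp)
  have h4 := abs_integral_dens_mul_cycle_le hn hk hkn had.symm hbd.symm hab (w := 1) (by simp)
  have h2' : 0 ≤ ∫ U, wt k a b U * wt k a d U ∂haarU n :=
    integral_nonneg fun U => mul_nonneg (wt_nonneg _ _ U) (wt_nonneg _ _ U)
  rw [hval] at hsum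
  set T := ∫ U, (gram k U a b * gram k U b d * gram k U d a).re ∂haarU n
  set q := ∫ U, wt k a b U * wt k a d U ∂haarU n
  set s := ∫ U, dens k b U * (1 * (gram k U b d * gram k U d a * gram k U a b)).re ∂haarU n
  set t := ∫ U, dens k d U * (1 * (gram k U d a * gram k U a b * gram k U b d)).re ∂haarU n
  have hn' : (4 : ℝ) ≤ n := by exact_mod_cast hn
  have hk' : (1 : ℝ) ≤ k := by exact_mod_cast hk
  have h5 : ((n : ℝ) - 3) * ((n : ℝ) ^ 4 * X - k)
      = ((n : ℝ) ^ 4 * T - n * k) - (n : ℝ) ^ 4 * q - (n : ℝ) ^ 4 * s - (n : ℝ) ^ 4 * t + 3 * k := by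
    linear_combination (n : ℝ) ^ 4 * hsum
  have h6 : ((n : ℝ) - 3) * |(n : ℝ) ^ 4 * X - k| ≤ 155 * (k : ℝ) ^ 2 := by
    have hn4 : (0 : ℝ) ≤ (n : ℝ) ^ 4 := by positivity
    have hs : |(n : ℝ) ^ 4 * s| ≤ 24 * (k : ℝ) ^ 2 := by rwa [abs_mul, abs_of_nonneg hn4]
    have ht : |(n : ℝ) ^ 4 * t| ≤ 24 * (k : ℝ) ^ 2 := by rwa [abs_mul, abs_of_nonneg hn4]
    rw [abs_le] at hs ht
    rw [← abs_of_nonneg (by linarith : (0 : ℝ) ≤ n - 3), ← abs_mul, h5, abs_le]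
    rw [abs_le] at h1
    have : 0 ≤ (n : ℝ) ^ 4 * q := by positivity
    constructor <;> nlinarith
  -- Here `n ≤ 4 (n - 3)`, with equality at `n = 4`.
  have h7 : (n : ℝ) * |(n : ℝ) ^ 4 * X - k| ≤ 4 * (155 * (k : ℝ) ^ 2) := by
    nlinarith [abs_nonneg ((n : ℝ) ^ 4 * X - k)]
  calc _ = (n : ℝ) * |(n : ℝ) ^ 4 * X - k| := by
        rw [← abs_of_nonneg (by linarith : (0 : ℝ) ≤ n), ← abs_mul,
          abs_of_nonneg (by linarith : (0 : ℝ) ≤ n)]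
        congr 1; ring
    _ ≤ _ := by linarith

/-! ### Averaging over phases -/

theorem integral_phase_average {ι : Type*} [Fintype ι] (u : ι → Fin n → ℂ)
    (hu : ∀ i a, conj (u i a) * u i a = 1) (f : Matrix (Fin n) (Fin n) ℂ → ℝ)
    (hf : Continuous f) :
    (Fintype.card ι : ℝ) * ∫ U, f (gram k U) ∂haarU n
      = ∫ U, ∑ i, f (Matrix.of fun a b => conj (u i a) * gram k U a b * u i b) ∂haarU n := by
  rw [integral_finsetSum]
  · simp [integral_gram_phase _ (hu _)]
  · intro i _
    refine integrable_of_continuous (hf.comp (continuous_matrix fun a b => ?_))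
    simp only [Matrix.of_apply]
    fun_prop

/-- The phase `i` or `1`. -/
def quarter (s : Bool) : ℂ := if s then Complex.I else 1

theorem conj_mul_quarter (s : Bool) : conj (quarter s) * quarter s = 1 := by
  cases s <;> simp [quarter]

theorem conj_mul_mul_phase {u v : Fin n → ℂ} (hu : ∀ a, conj (u a) * u a = 1)
    (hv : ∀ a, conj (v a) * v a = 1) (a : Fin n) :
    conj ((u * v) a) * (u * v) a = 1 := by
  rw [Pi.mul_apply, map_mul]
  linear_combination conj (v a) * v a * hu a + hv a

/-- Writing `Im X = (X - conj X) / 2i` gives sixteen terms, in which each vertex phase has exponent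
`0` or `±2`; averaging over `{1, i}` kills exponent `±2`. Exponent `0` at `a`, `b`, `c` already
forces all four edges to be conjugated or none, so no phase at `d` is needed. The two survivors have
coefficient `1 / 16` and add up to `1 / 8` of a real part. -/
theorem integral_four_im {a b c d : Fin n} (hab : a ≠ b) (hac : a ≠ c) (had : a ≠ d)
    (hbc : b ≠ c) (hbd : b ≠ d) (hcd : c ≠ d) (α β γ δ : ℂ) :
    ∫ U, (α * gram k U a b).im * (β * gram k U b c).im * (γ * gram k U c d).im
        * (δ * gram k U d a).im ∂haarU n
      = (1 / 8) * ∫ U, (α * β * γ * δ *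
          (gram k U a b * gram k U b c * gram k U c d * gram k U d a)).re ∂haarU n := by
  have h := integral_phase_average (k := k) (ι := Bool × Bool × Bool)
    (fun s => phaseAt a (quarter s.1) * phaseAt b (quarter s.2.1) * phaseAt c (quarter s.2.2))
    (fun s => conj_mul_mul_phase (conj_mul_mul_phase (conj_mul_phaseAt a (conj_mul_quarter _))
      (conj_mul_phaseAt b (conj_mul_quarter _))) (conj_mul_phaseAt c (conj_mul_quarter _)))
    (fun A => (α * A a b).im * (β * A b c).im * (γ * A c d).im * (δ * A d a).im)
    (by
      have : ∀ (w : ℂ) (x y : Fin n),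
          Continuous fun A : Matrix (Fin n) (Fin n) ℂ => (w * A x y).im := fun w x y =>
        Complex.continuous_im.comp (continuous_const.mul (continuous_id.matrix_elem x y))
      exact (((this _ _ _).mul (this _ _ _)).mul (this _ _ _)).mul (this _ _ _))
  have hcard : (Fintype.card (Bool × Bool × Bool) : ℝ) = 8 := by norm_num [Fintype.card_prod]
  rw [hcard] at h
  suffices hs : ∀ U : UnitaryGrp n, ∑ s : Bool × Bool × Bool,
      (fun A : Matrix (Fin n) (Fin n) ℂ =>
        (α * A a b).im * (β * A b c).im * (γ * A c d).im * (δ * A d a).im)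
        (Matrix.of fun x y => conj ((phaseAt a (quarter s.1) * phaseAt b (quarter s.2.1)
          * phaseAt c (quarter s.2.2)) x) * gram k U x y * (phaseAt a (quarter s.1)
          * phaseAt b (quarter s.2.1) * phaseAt c (quarter s.2.2)) y)
      = (α * β * γ * δ * (gram k U a b * gram k U b c * gram k U c d * gram k U d a)).re by
    simp only [hs] at h
    linarith
  intro U
  simp only [Matrix.of_apply, Pi.mul_apply, phaseAt_self, phaseAt_of_ne hab, phaseAt_of_ne hac,
    phaseAt_of_ne hab.symm, phaseAt_of_ne hbc, phaseAt_of_ne hbc.symm, phaseAt_of_ne hac.symm,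
    phaseAt_of_ne had.symm, phaseAt_of_ne hbd.symm, phaseAt_of_ne hcd.symm, mul_one, one_mul,
    map_one]
  have e : ∀ α e₁ x e₂ : ℂ, α * (e₁ * x * e₂) = e₁ * (α * x) * e₂ := fun _ _ _ _ => by ring
  have e' : ∀ α x e₂ : ℂ, α * (x * e₂) = α * x * e₂ := fun _ _ _ => by ring
  have e'' : ∀ α e₂ x : ℂ, α * (e₂ * x) = e₂ * (α * x) := fun _ _ _ => by ring
  have e3 : α * β * γ * δ * (gram k U a b * gram k U b c * gram k U c d * gram k U d a)
      = (α * gram k U a b) * (β * gram k U b c) * (γ * gram k U c d) * (δ * gram k U d a) := by ring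
  rw [e3]
  simp only [e α, e β, e' δ, e'' γ]
  generalize α * gram k U a b = X
  generalize β * gram k U b c = Y
  generalize γ * gram k U c d = Z
  generalize δ * gram k U d a = V
  simp only [Fintype.sum_prod_type, Fintype.sum_bool, quarter, if_true, Bool.false_eq_true,
    if_false, map_one, Complex.conj_I, Complex.mul_im, Complex.mul_re, Complex.I_re, Complex.I_im,
    Complex.neg_re, Complex.neg_im, Complex.one_re, Complex.one_im]
  ring

/-- The same averaging on a triangle, where phases at `c` and `d` suffice. Now `(2i)⁻³ = i / 8`,
whence the factor `I` and the constant `1 / 4`. -/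
theorem integral_dens_mul_three_im {a c d : Fin n} (hac : a ≠ c) (had : a ≠ d)
    (hcd : c ≠ d) (α β γ : ℂ) :
    ∫ U, dens k a U * (α * gram k U a c).im * (β * gram k U c d).im * (γ * gram k U d a).im ∂haarU n
      = (1 / 4) * ∫ U, dens k a U * (Complex.I * α * β * γ *
          (gram k U a c * gram k U c d * gram k U d a)).re ∂haarU n := by
  have h := integral_phase_average (k := k) (ι := Bool × Bool)
    (fun s => phaseAt c (quarter s.1) * phaseAt d (quarter s.2))
    (fun s => conj_mul_mul_phase (conj_mul_phaseAt c (conj_mul_quarter _))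
      (conj_mul_phaseAt d (conj_mul_quarter _)))
    (fun A => (A a a).re * (α * A a c).im * (β * A c d).im * (γ * A d a).im)
    (by
      have h1 : ∀ (w : ℂ) (x y : Fin n),
          Continuous fun A : Matrix (Fin n) (Fin n) ℂ => (w * A x y).im := fun w x y =>
        Complex.continuous_im.comp (continuous_const.mul (continuous_id.matrix_elem x y))
      have h2 : Continuous fun A : Matrix (Fin n) (Fin n) ℂ => (A a a).re :=
        Complex.continuous_re.comp (continuous_id.matrix_elem a a)
      exact ((h2.mul (h1 _ _ _)).mul (h1 _ _ _)).mul (h1 _ _ _))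
  have hcard : (Fintype.card (Bool × Bool) : ℝ) = 4 := by norm_num [Fintype.card_prod]
  rw [hcard] at h
  suffices hs : ∀ U : UnitaryGrp n, ∑ s : Bool × Bool,
      (fun A : Matrix (Fin n) (Fin n) ℂ =>
        (A a a).re * (α * A a c).im * (β * A c d).im * (γ * A d a).im)
        (Matrix.of fun x y => conj ((phaseAt c (quarter s.1) * phaseAt d (quarter s.2)) x)
          * gram k U x y * (phaseAt c (quarter s.1) * phaseAt d (quarter s.2)) y)
      = dens k a U * (Complex.I * α * β * γ *
          (gram k U a c * gram k U c d * gram k U d a)).re by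
    simp only [hs] at h
    simp only [dens] at h ⊢
    linarith
  intro U
  simp only [Matrix.of_apply, Pi.mul_apply, phaseAt_self, phaseAt_of_ne hac,
    phaseAt_of_ne had, phaseAt_of_ne hcd, phaseAt_of_ne hcd.symm, mul_one, one_mul,
    map_one]
  have e : ∀ α e₁ x e₂ : ℂ, α * (e₁ * x * e₂) = e₁ * (α * x) * e₂ := fun _ _ _ _ => by ring
  have e' : ∀ α x e₂ : ℂ, α * (x * e₂) = α * x * e₂ := fun _ _ _ => by ring
  have e'' : ∀ α e₂ x : ℂ, α * (e₂ * x) = e₂ * (α * x) := fun _ _ _ => by ring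
  have e3 : Complex.I * α * β * γ * (gram k U a c * gram k U c d * gram k U d a)
      = Complex.I * ((α * gram k U a c) * (β * gram k U c d) * (γ * gram k U d a)) := by ring
  rw [e3]
  simp only [e β, e' α, e'' γ, dens]
  generalize α * gram k U a c = X
  generalize β * gram k U c d = Y
  generalize γ * gram k U d a = Z
  simp only [Fintype.sum_prod_type, Fintype.sum_bool, quarter, if_true, Bool.false_eq_true,
    if_false, map_one, Complex.conj_I, Complex.mul_im, Complex.mul_re, Complex.I_re, Complex.I_im,
    Complex.neg_re, Complex.neg_im, Complex.one_re, Complex.one_im]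
  ring

/-! ### The restricted symplectic form -/

/-- The mode of a phase space coordinate. -/
def mode : Fin n ⊕ Fin n → Fin n := Sum.elim id id

/-- The phase of a phase space coordinate: `1` for positions and `-i` for momenta. -/
def coordPhase : Fin n ⊕ Fin n → ℂ := Sum.elim (fun _ => 1) (fun _ => -Complex.I)

/-- The entries of `η(U)ᵀ J_k η(U)`, the symplectic form restricted to the first `k` modes. -/
def sform (k : ℕ) (x y : Fin n ⊕ Fin n) (U : UnitaryGrp n) : ℝ :=
  (conj (coordPhase x) * coordPhase y * gram k U (mode x) (mode y)).im

theorem coordPhase_mul_conj (x : Fin n ⊕ Fin n) : coordPhase x * conj (coordPhase x) = 1 := by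
  cases x <;> simp [coordPhase]

theorem norm_coordPhase (x : Fin n ⊕ Fin n) : ‖coordPhase x‖ = 1 := by
  cases x <;> simp [coordPhase]

@[fun_prop]
theorem continuous_sform (x y : Fin n ⊕ Fin n) :
    Continuous (sform k x y : UnitaryGrp n → ℝ) := by
  unfold sform; fun_prop

theorem sform_sq_le (x y : Fin n ⊕ Fin n) (U : UnitaryGrp n) :
    sform k x y U ^ 2 ≤ wt k (mode x) (mode y) U := by
  have h1 : |sform k x y U| ≤ ‖gram k U (mode x) (mode y)‖ := by
    refine (Complex.abs_im_le_norm _).trans ?_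
    simp [norm_coordPhase]
  rw [wt, Complex.normSq_eq_norm_sq, ← sq_abs]
  gcongr

theorem sform_self (x : Fin n ⊕ Fin n) (U : UnitaryGrp n) : sform k x x U = 0 := by
  rw [sform, mul_comm (conj _), coordPhase_mul_conj, gram_self]; simp

theorem exists_sform_eq {x y : Fin n ⊕ Fin n} (hm : mode x = mode y) (hne : x ≠ y) :
    ∃ s : ℝ, |s| = 1 ∧ ∀ U : UnitaryGrp n, sform k x y U = s * dens k (mode x) U := by
  rcases x with a | a <;> rcases y with b | b <;> simp only [mode, Sum.elim_inl, Sum.elim_inr, id] at hm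
  · exact absurd (by rw [hm]) hne
  · exact ⟨-1, by simp, fun U => by subst hm; simp [sform, coordPhase, mode, gram_self]⟩
  · exact ⟨1, by simp, fun U => by subst hm; simp [sform, coordPhase, mode, gram_self]⟩
  · exact absurd (by rw [hm]) hne

theorem abs_mul_four_le (a b c d p q : ℝ) (h1 : a ^ 2 ≤ p) (h2 : b ^ 2 ≤ q) (h3 : c ^ 2 ≤ q)
    (h4 : d ^ 2 ≤ p) : |a * b * c * d| ≤ p * q := by
  have hp : 0 ≤ p := (sq_nonneg a).trans h1
  have hq : 0 ≤ q := (sq_nonneg b).trans h2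
  refine abs_le_of_sq_le_sq ?_ (by positivity)
  calc (a * b * c * d) ^ 2 = (a ^ 2 * d ^ 2) * (b ^ 2 * c ^ 2) := by ring
    _ ≤ (p * p) * (q * q) := by gcongr
    _ = _ := by ring

/-- The expectation of a cyclic product of four entries of the restricted symplectic form. -/
def cycleMean (k : ℕ) (x y w v : Fin n ⊕ Fin n) : ℝ :=
  ∫ U, sform k x y U * sform k y w U * sform k w v U * sform k v x U ∂haarU n

theorem cycleMean_rotate (x y w v : Fin n ⊕ Fin n) :
    cycleMean k x y w v = cycleMean k y w v x := by
  unfold cycleMean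
  congr 1
  ext U
  ring

theorem abs_cycleMean_sub_le (hn : 4 ≤ n) (hk : 1 ≤ k) (hkn : k ≤ n) {x y w v : Fin n ⊕ Fin n}
    (hab : mode x ≠ mode y) (hac : mode x ≠ mode w) (had : mode x ≠ mode v)
    (hbc : mode y ≠ mode w) (hbd : mode y ≠ mode v) (hcd : mode w ≠ mode v) :
    |(n : ℝ) ^ 5 * cycleMean k x y w v - n * k / 8| ≤ 78 * (k : ℝ) ^ 2 := by
  have h := abs_integral_four_cycle_sub_le hn hk hkn hab hac had hbc hbd hcd
  have e : cycleMean k x y w v = (1 / 8) * ∫ U, (gram k U (mode x) (mode y)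
      * gram k U (mode y) (mode w) * gram k U (mode w) (mode v) * gram k U (mode v) (mode x)).re
      ∂haarU n := by
    refine (integral_four_im hab hac had hbc hbd hcd _ _ _ _).trans ?_
    -- The coordinate phases telescope around the cycle, so the leading value does not depend on
    -- which coordinates are positions or momenta.
    have : conj (coordPhase x) * coordPhase y * (conj (coordPhase y) * coordPhase w)
        * (conj (coordPhase w) * coordPhase v) * (conj (coordPhase v) * coordPhase x) = 1 := by
      calc _ = (coordPhase x * conj (coordPhase x)) * (coordPhase y * conj (coordPhase y))
          * (coordPhase w * conj (coordPhase w)) * (coordPhase v * conj (coordPhase v)) := by ring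
        _ = 1 := by simp only [coordPhase_mul_conj, mul_one]
    simp only [this, one_mul]
  rw [e]
  rw [abs_le] at h ⊢
  constructor <;> nlinarith

/-- The four factors link mode `x` twice to mode `y` and twice to mode `v`, so the product is at
most `|G_ab|² |G_ad|²`. AM-GM reduces this to fourth moments, which also covers equal modes of `y`
and `v`. -/
theorem abs_cycleMean_le_of_opposite (hn : 4 ≤ n) (hk : 1 ≤ k) (hkn : k ≤ n)
    {x y w v : Fin n ⊕ Fin n} (hab : mode x ≠ mode y) (had : mode x ≠ mode v)
    (hac : mode x = mode w) :
    (n : ℝ) ^ 4 * |cycleMean k x y w v| ≤ 48 * (k : ℝ) ^ 2 := by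
  have h1 := integral_wt_sq_le hn hk hkn hab
  have h2 := integral_wt_sq_le hn hk hkn had
  have hle : |cycleMean k x y w v|
      ≤ ((∫ U, wt k (mode x) (mode y) U ^ 2 ∂haarU n)
        + ∫ U, wt k (mode x) (mode v) U ^ 2 ∂haarU n) * (1 / 2) := by
    rw [← integral_add, ← integral_mul_const]
    · refine abs_integral_le_integral_abs.trans (integral_mono
        (integrable_of_continuous (Continuous.abs (by fun_prop)))
        (integrable_of_continuous (by fun_prop)) fun U => ?_)
      have hp : (sform k x y U * sform k y w U * sform k w v U * sform k v x U)
          = sform k x y U * sform k w v U * sform k v x U * sform k y w U := by ring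
      dsimp only
      rw [hp]
      refine (abs_mul_four_le _ _ _ _ (wt k (mode x) (mode y) U) (wt k (mode x) (mode v) U)
        (sform_sq_le x y U) ?_ ?_ ?_).trans ?_
      · rw [hac]; exact sform_sq_le w v U
      · rw [wt_comm]; exact sform_sq_le v x U
      · rw [wt_comm, hac]; exact sform_sq_le y w U
      · nlinarith [sq_nonneg (wt k (mode x) (mode y) U - wt k (mode x) (mode v) U)]
    all_goals exact integrable_of_continuous (by fun_prop)
  nlinarith [mul_le_mul_of_nonneg_left hle (by positivity : (0 : ℝ) ≤ (n : ℝ) ^ 4)]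

/-- The indicator that two phase space coordinates belong to the same mode. -/
def sameMode (x y : Fin n ⊕ Fin n) : ℝ := if mode x = mode y then 1 else 0

theorem sameMode_nonneg (x y : Fin n ⊕ Fin n) : 0 ≤ sameMode x y := by
  unfold sameMode; split_ifs <;> norm_num

theorem cycleMean_self (x w v : Fin n ⊕ Fin n) : cycleMean k x x w v = 0 := by
  simp [cycleMean, sform_self]

/-- The first factor is `±G_aa`. Each further coincidence of modes costs a factor `n`, or `n²` if
all four modes agree; the sums over coinciding modes are shorter by as much. -/
theorem abs_cycleMean_le_of_adjacent (hn : 4 ≤ n) (hk : 1 ≤ k) (hkn : k ≤ n)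
    {x y : Fin n ⊕ Fin n} (w v : Fin n ⊕ Fin n) (hm : mode x = mode y) (hne : x ≠ y) :
    (n : ℝ) ^ 4 * |cycleMean k x y w v| ≤ 12 * (k : ℝ) ^ 2 *
      (1 + n * sameMode w v + n * sameMode x w + n * sameMode x v
        + n ^ 2 * (sameMode x w * sameMode x v)) := by
  obtain ⟨s, hs, hxy⟩ := exists_sform_eq (k := k) hm hne
  have hn' : (4 : ℝ) ≤ n := by exact_mod_cast hn
  have hk2 : (0 : ℝ) ≤ 12 * (k : ℝ) ^ 2 := by positivity
  have n1 := mul_nonneg (by linarith : (0 : ℝ) ≤ n) (sameMode_nonneg w v)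
  have n2 := mul_nonneg (by linarith : (0 : ℝ) ≤ n) (sameMode_nonneg x w)
  have n3 := mul_nonneg (by linarith : (0 : ℝ) ≤ n) (sameMode_nonneg x v)
  have n4 := mul_nonneg (by positivity : (0 : ℝ) ≤ (n : ℝ) ^ 2)
    (mul_nonneg (sameMode_nonneg x w) (sameMode_nonneg x v))
  have crude : ∀ f : UnitaryGrp n → ℝ, Continuous f →
      (∀ U, |sform k x y U * sform k y w U * sform k w v U * sform k v x U| ≤ f U) →
      |cycleMean k x y w v| ≤ ∫ U, f U ∂haarU n := fun f hf hle =>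
    abs_integral_le_integral_abs.trans (integral_mono
        (integrable_of_continuous (Continuous.abs (by fun_prop)))
        (integrable_of_continuous hf) hle)
  have hdens : ∀ (z : Fin n ⊕ Fin n) (U : UnitaryGrp n), mode x = mode z →
      ∀ z', mode x = mode z' → |sform k z z' U| ≤ dens k (mode x) U := fun z U hz z' hz' => by
    refine abs_le_of_sq_le_sq ?_ (dens_nonneg _ U)
    rw [← wt_self]
    have h := sform_sq_le (k := k) z z' U
    rwa [← hz, ← hz'] at h
  have habs : ∀ U : UnitaryGrp n, |sform k x y U| = dens k (mode x) U := fun U => by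
    rw [hxy, abs_mul, hs, one_mul, abs_of_nonneg (dens_nonneg _ U)]
  -- For exactly one further coincidence: `a` is an entry within a mode, `b` and `c` join the same
  -- two modes.
  have hprod : ∀ (p a b c q : ℝ), 0 ≤ p → |a| ≤ 1 → b ^ 2 ≤ q → c ^ 2 ≤ q →
      p * |a| * |b| * |c| ≤ p * q := by
    intro p a b c q hp ha hb hc
    have hbc : |b| * |c| ≤ q := by
      rw [← sq_abs] at hb hc
      nlinarith [sq_nonneg (|b| - |c|)]
    calc p * |a| * |b| * |c| = p * (|a| * (|b| * |c|)) := by ring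
      _ ≤ p * (1 * q) := by gcongr
      _ = p * q := by ring
  have hle1 : ∀ z z' (U : UnitaryGrp n), mode z = mode z' → |sform k z z' U| ≤ 1 :=
    fun z z' U hz => by
      refine abs_le_of_sq_le_sq ?_ zero_le_one
      refine (sform_sq_le z z' U).trans ?_
      rw [← hz, wt_self]
      have := dens_nonneg (k := k) (mode z) U
      have := dens_le_one (k := k) (mode z) U
      nlinarith
  by_cases hac : mode x = mode w
  · by_cases had : mode x = mode v
    · have h := crude (fun U => dens k (mode x) U ^ 2) (by fun_prop) fun U => by
        rw [abs_mul, abs_mul, abs_mul, habs]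
        have h1 := hle1 y w U (hm.symm.trans hac)
        have h2 := hle1 w v U (hac.symm.trans had)
        have h3 := hdens v U had x rfl
        have h0 := dens_nonneg (k := k) (mode x) U
        calc _ ≤ dens k (mode x) U * 1 * 1 * dens k (mode x) U := by gcongr
          _ = _ := by ring
      have h2 := integral_dens_sq_le (by omega) hk hkn (mode x)
      have e1 : sameMode x w = 1 := if_pos hac
      have e2 : sameMode x v = 1 := if_pos had
      have : (n : ℝ) ^ 4 * |cycleMean k x y w v| ≤ 12 * (k : ℝ) ^ 2 * n ^ 2 := by
        have := mul_le_mul_of_nonneg_left h (by positivity : (0 : ℝ) ≤ (n : ℝ) ^ 4)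
        nlinarith [mul_le_mul_of_nonneg_left h2 (by positivity : (0 : ℝ) ≤ (n : ℝ) ^ 2)]
      refine this.trans (mul_le_mul_of_nonneg_left ?_ hk2)
      rw [e1, e2] at n4 ⊢
      rw [e1] at n2
      rw [e2] at n3
      linarith
    · have h := crude (fun U => dens k (mode x) U * wt k (mode x) (mode v) U) (by fun_prop)
        fun U => by
          rw [abs_mul, abs_mul, abs_mul, habs]
          refine hprod _ _ _ _ _ (dens_nonneg _ U) (hle1 y w U (hm.symm.trans hac)) ?_ ?_
          · rw [hac]; exact sform_sq_le w v U
          · rw [wt_comm]; exact sform_sq_le v x U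
      have h2 := integral_dens_mul_wt_le (by omega) hk hkn had
      have e1 : sameMode x w = 1 := if_pos hac
      have : (n : ℝ) ^ 4 * |cycleMean k x y w v| ≤ 12 * (k : ℝ) ^ 2 * n := by
        have := mul_le_mul_of_nonneg_left h (by positivity : (0 : ℝ) ≤ (n : ℝ) ^ 4)
        nlinarith
      refine this.trans (mul_le_mul_of_nonneg_left ?_ hk2)
      rw [e1] at n4 ⊢
      linarith
  · by_cases had : mode x = mode v
    · have h := crude (fun U => dens k (mode x) U * wt k (mode x) (mode w) U) (by fun_prop)
        fun U => by
          rw [show sform k x y U * sform k y w U * sform k w v U * sform k v x U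
            = sform k x y U * sform k v x U * sform k y w U * sform k w v U by ring,
            abs_mul, abs_mul, abs_mul, habs]
          refine hprod _ _ _ _ _ (dens_nonneg _ U) (hle1 v x U had.symm) ?_ ?_
          · rw [hm]; exact sform_sq_le y w U
          · rw [wt_comm, had]; exact sform_sq_le w v U
      have h2 := integral_dens_mul_wt_le (by omega) hk hkn hac
      have e1 : sameMode x v = 1 := if_pos had
      have : (n : ℝ) ^ 4 * |cycleMean k x y w v| ≤ 12 * (k : ℝ) ^ 2 * n := by
        have := mul_le_mul_of_nonneg_left h (by positivity : (0 : ℝ) ≤ (n : ℝ) ^ 4)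
        nlinarith
      refine this.trans (mul_le_mul_of_nonneg_left ?_ hk2)
      rw [e1] at n4 ⊢
      linarith
    · by_cases hcd : mode w = mode v
      · have h := crude (fun U => dens k (mode x) U * wt k (mode x) (mode w) U) (by fun_prop)
          fun U => by
            rw [show sform k x y U * sform k y w U * sform k w v U * sform k v x U
              = sform k x y U * sform k w v U * sform k y w U * sform k v x U by ring,
              abs_mul, abs_mul, abs_mul, habs]
            refine hprod _ _ _ _ _ (dens_nonneg _ U) (hle1 w v U hcd) ?_ ?_
            · rw [hm]; exact sform_sq_le y w U
            · rw [wt_comm, hcd]; exact sform_sq_le v x U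
        have h2 := integral_dens_mul_wt_le (by omega) hk hkn hac
        have e1 : sameMode w v = 1 := if_pos hcd
        have : (n : ℝ) ^ 4 * |cycleMean k x y w v| ≤ 12 * (k : ℝ) ^ 2 * n := by
          have := mul_le_mul_of_nonneg_left h (by positivity : (0 : ℝ) ≤ (n : ℝ) ^ 4)
          nlinarith
        refine this.trans (mul_le_mul_of_nonneg_left ?_ hk2)
        rw [e1]
        linarith
      -- Sizes alone do not suffice here: with `|G_ac|` of order `√k / n`, absolute values would
      -- heuristically give `k^(5/2) / n⁴`. Phase averaging restores the cyclic product and its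
      -- cancellation.
      · have e : cycleMean k x y w v = s * ((1 / 4) * ∫ U, dens k (mode x) U *
            (Complex.I * (conj (coordPhase y) * coordPhase w) * (conj (coordPhase w) * coordPhase v)
              * (conj (coordPhase v) * coordPhase x) * (gram k U (mode x) (mode w)
              * gram k U (mode w) (mode v) * gram k U (mode v) (mode x))).re ∂haarU n) := by
          rw [← integral_dens_mul_three_im hac had hcd, ← integral_const_mul]
          unfold cycleMean
          congr 1
          ext U
          rw [hxy]
          simp only [sform, hm]
          ring
        have h := abs_integral_dens_mul_cycle_le hn hk hkn hac had hcd
          (w := Complex.I * (conj (coordPhase y) * coordPhase w)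
            * (conj (coordPhase w) * coordPhase v) * (conj (coordPhase v) * coordPhase x))
          (by simp [norm_coordPhase])
        rw [e, abs_mul, hs, abs_mul, abs_of_pos (by norm_num : (0 : ℝ) < 1 / 4)]
        have : 12 * (k : ℝ) ^ 2 * 1 ≤ 12 * (k : ℝ) ^ 2 *
            (1 + n * sameMode w v + n * sameMode x w + n * sameMode x v
              + n ^ 2 * (sameMode x w * sameMode x v)) :=
          mul_le_mul_of_nonneg_left (by linarith) hk2
        have hk0 : (0 : ℝ) ≤ (k : ℝ) ^ 2 := by positivity
        linarith

/-! ### The fourth moment as a sum of cyclic products -/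

/-- The diagonal of `Z ⊕ Z⁻¹`. -/
def squeezeDiag (z : Fin n → ℝ) : Fin n ⊕ Fin n → ℝ := Sum.elim z fun j => (z j)⁻¹

theorem squeezedCov_eq_diagonal (z : Fin n → ℝ) :
    squeezedCov z = Matrix.diagonal (squeezeDiag z) := by
  rw [squeezedCov, Matrix.fromBlocks_diagonal]; rfl

theorem gram_apply (U : UnitaryGrp n) (a b : Fin n) :
    gram k U a b = ∑ j : Fin n, if (j : ℕ) < k then conj (U.1 j a) * U.1 j b else 0 := by
  rw [gram, Matrix.mul_apply]
  refine Finset.sum_congr rfl fun j _ => ?_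
  rw [Matrix.mul_diagonal, Matrix.star_apply]
  by_cases h : (j : ℕ) < k <;> simp [h]

theorem eta_transpose_mul_mul_eta (U : UnitaryGrp n) :
    (eta U).transpose * (modeProj n k * Matrix.J (Fin n) ℝ * modeProj n k) * eta U
      = Matrix.of fun x y => sform k x y U := by
  have hJ : modeProj n k * Matrix.J (Fin n) ℝ * modeProj n k = Matrix.fromBlocks 0
      (-Matrix.diagonal fun j : Fin n => if (j : ℕ) < k then (1 : ℝ) else 0)
      (Matrix.diagonal fun j : Fin n => if (j : ℕ) < k then 1 else 0) 0 := by
    have hD : (Matrix.diagonal fun j : Fin n => if (j : ℕ) < k then (1 : ℝ) else 0)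
        * (Matrix.diagonal fun j : Fin n => if (j : ℕ) < k then 1 else 0)
        = Matrix.diagonal fun j : Fin n => if (j : ℕ) < k then 1 else 0 := by
      rw [Matrix.diagonal_mul_diagonal]
      congr 1
      ext j
      split_ifs <;> simp
    simp only [modeProj, Matrix.J, Matrix.fromBlocks_multiply, Matrix.zero_mul, Matrix.mul_zero,
      Matrix.mul_neg, Matrix.neg_mul, Matrix.mul_one, add_zero, zero_add, hD, neg_zero]
  rw [hJ, eta, Matrix.fromBlocks_transpose, Matrix.fromBlocks_multiply,
    Matrix.fromBlocks_multiply]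
  ext x y
  rcases x with a | a <;> rcases y with b | b <;>
    simp only [Matrix.of_apply, Matrix.fromBlocks_apply₁₁, Matrix.fromBlocks_apply₁₂,
      Matrix.fromBlocks_apply₂₁, Matrix.fromBlocks_apply₂₂, Matrix.mul_zero, zero_add, add_zero,
      Matrix.mul_neg, Matrix.neg_mul, Matrix.transpose_neg, Matrix.add_apply, Matrix.neg_apply,
      neg_neg, Matrix.mul_apply (M := _ * Matrix.diagonal _), Matrix.mul_diagonal,
      Matrix.transpose_apply, Matrix.map_apply, sform, coordPhase, mode, Sum.elim_inl,
      Sum.elim_inr, id, gram_apply, Finset.mul_sum, Complex.im_sum, ← Finset.sum_neg_distrib,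
      ← Finset.sum_add_distrib] <;>
    refine Finset.sum_congr rfl fun j _ => ?_ <;>
    by_cases h : (j : ℕ) < k <;>
    simp [h]
  all_goals ring

theorem trace_pow_four {ι : Type*} [Fintype ι] [DecidableEq ι] (d : ι → ℝ) (A : Matrix ι ι ℝ) :
    ((Matrix.diagonal d * A) ^ 4).trace
      = ∑ x, ∑ y, ∑ w, ∑ v, d x * d y * d w * d v * (A x y * A y w * A w v * A v x) := by
  have h : (Matrix.diagonal d * A) ^ 4 = (Matrix.diagonal d * A) * ((Matrix.diagonal d * A)
      * ((Matrix.diagonal d * A) * (Matrix.diagonal d * A))) := by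
    noncomm_ring
  rw [h, Matrix.trace]
  simp only [Matrix.diag_apply, Matrix.mul_apply (M := Matrix.diagonal d * A),
    Matrix.diagonal_mul, Finset.mul_sum]
  refine Finset.sum_congr rfl fun x _ => Finset.sum_congr rfl fun y _ =>
    Finset.sum_congr rfl fun w _ => Finset.sum_congr rfl fun v _ => ?_
  ring

theorem trace_mul_pow_four_comm {ι : Type*} [Fintype ι] [DecidableEq ι] (A B : Matrix ι ι ℝ) :
    ((A * B) ^ 4).trace = ((B * A) ^ 4).trace := by
  have h : (A * B) ^ 4 = A * (B * (A * B) ^ 3) := by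
    rw [pow_succ', Matrix.mul_assoc]
  rw [h, Matrix.trace_mul_comm]
  congr 1
  simp only [pow_succ, pow_zero, Matrix.one_mul, Matrix.mul_assoc]

/-- Splitting `J M` at the diagonal matrix `Z ⊕ Z⁻¹` and exchanging the two factors under the trace
puts all the randomness into the restricted symplectic form. -/
theorem trace_J_mul_reducedCov (z : Fin n → ℝ) (U : UnitaryGrp n) :
    ((Matrix.J (Fin n) ℝ * reducedCov z k U) ^ 4).trace
      = ∑ x, ∑ y, ∑ w, ∑ v, squeezeDiag z x * squeezeDiag z y * squeezeDiag z w * squeezeDiag z v *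
        (sform k x y U * sform k y w U * sform k w v U * sform k v x U) := by
  set A := Matrix.J (Fin n) ℝ * modeProj n k * eta U with hA
  set B := squeezedCov z * (eta U).transpose * modeProj n k with hB
  have h1 : Matrix.J (Fin n) ℝ * reducedCov z k U = A * B := by
    simp only [hA, hB, reducedCov, fullCov, Matrix.mul_assoc]
  have h2 : B * A = Matrix.diagonal (squeezeDiag z) * Matrix.of fun x y => sform k x y U := by
    rw [← eta_transpose_mul_mul_eta, ← squeezedCov_eq_diagonal]
    simp only [hA, hB, Matrix.mul_assoc]
  rw [h1, trace_mul_pow_four_comm, h2, trace_pow_four]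
  rfl

theorem fourthMoment_eq_sum (z : Fin n → ℝ) :
    fourthMoment z k = ∑ x, ∑ y, ∑ w, ∑ v,
      squeezeDiag z x * squeezeDiag z y * squeezeDiag z w * squeezeDiag z v *
        cycleMean k x y w v := by
  simp only [fourthMoment, trace_J_mul_reducedCov]
  rw [integral_finsetSum _ fun x _ => integrable_of_continuous (by fun_prop)]
  refine Finset.sum_congr rfl fun x _ => ?_
  rw [integral_finsetSum _ fun y _ => integrable_of_continuous (by fun_prop)]
  refine Finset.sum_congr rfl fun y _ => ?_
  rw [integral_finsetSum _ fun w _ => integrable_of_continuous (by fun_prop)]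
  refine Finset.sum_congr rfl fun w _ => ?_
  rw [integral_finsetSum _ fun v _ => integrable_of_continuous (by fun_prop)]
  refine Finset.sum_congr rfl fun v _ => ?_
  rw [integral_const_mul]
  rfl

theorem sum_squeezeDiag (hn : n ≠ 0) (z : Fin n → ℝ) :
    ∑ x, squeezeDiag z x = 2 * n * avgEnergy z := by
  rw [avgEnergy, squeezedCov_eq_diagonal, Matrix.trace_diagonal]
  field_simp

theorem squeezeDiag_pos {z : Fin n → ℝ} (hz : ∀ j, 1 ≤ z j) (x : Fin n ⊕ Fin n) :
    0 < squeezeDiag z x := by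
  rcases x with j | j <;> simp only [squeezeDiag, Sum.elim_inl, Sum.elim_inr]
  · linarith [hz j]
  · exact inv_pos.mpr (by linarith [hz j])

theorem squeezeDiag_le {z : Fin n → ℝ} (hz : ∀ j, 1 ≤ z j) {Z : ℝ} (h1 : 1 ≤ Z)
    (hZ : ∀ j, z j ≤ Z) (x : Fin n ⊕ Fin n) : squeezeDiag z x ≤ Z := by
  rcases x with j | j <;> simp only [squeezeDiag, Sum.elim_inl, Sum.elim_inr]
  · exact hZ j
  · exact (inv_le_one_of_one_le₀ (hz j)).trans h1

/-- This keeps the error linear in `Z`: bounding both weights by `Z` would give higher powers when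
three or four modes coincide. -/
theorem squeezeDiag_mul_eq_one {z : Fin n → ℝ} (hz : ∀ j, 1 ≤ z j) {x y : Fin n ⊕ Fin n}
    (hm : mode x = mode y) (hne : x ≠ y) : squeezeDiag z x * squeezeDiag z y = 1 := by
  rcases x with a | a <;> rcases y with b | b <;>
    simp only [mode, Sum.elim_inl, Sum.elim_inr, id] at hm <;> subst hm
  · exact absurd rfl hne
  · exact mul_inv_cancel₀ (zero_lt_one.trans_le (hz a)).ne'
  · exact inv_mul_cancel₀ (zero_lt_one.trans_le (hz a)).ne'
  · exact absurd rfl hne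

/-! ### Sums over coinciding modes -/

theorem sum_sameMode_mul (x : Fin n ⊕ Fin n) (f : Fin n ⊕ Fin n → ℝ) :
    ∑ y, sameMode x y * f y = f (Sum.inl (mode x)) + f (Sum.inr (mode x)) := by
  have h1 : ∀ a, sameMode x (Sum.inl a) = if mode x = a then 1 else 0 := fun _ => rfl
  have h2 : ∀ a, sameMode x (Sum.inr a) = if mode x = a then 1 else 0 := fun _ => rfl
  rw [Fintype.sum_sum_type]
  simp [h1, h2]

theorem sameMode_comm (x y : Fin n ⊕ Fin n) : sameMode x y = sameMode y x := by
  simp only [sameMode, eq_comm]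

theorem sum_sameMode (x : Fin n ⊕ Fin n) : ∑ y, sameMode x y = 2 := by
  have := sum_sameMode_mul x fun _ => 1
  simp only [mul_one] at this
  rw [this]; norm_num

theorem sum_rotate {ι : Type*} [Fintype ι] (F : ι → ι → ι → ι → ℝ) :
    ∑ x, ∑ y, ∑ w, ∑ v, F y w v x = ∑ x, ∑ y, ∑ w, ∑ v, F x y w v := by
  rw [Finset.sum_comm]
  refine Finset.sum_congr rfl fun y _ => ?_
  rw [Finset.sum_comm]
  refine Finset.sum_congr rfl fun w _ => ?_
  rw [Finset.sum_comm]

theorem sum_sum_sameMode_mul (d : Fin n ⊕ Fin n → ℝ) :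
    ∑ x, ∑ y, sameMode x y * d y = 2 * ∑ x, d x := by
  rw [Finset.sum_comm, Finset.mul_sum]
  refine Finset.sum_congr rfl fun y _ => ?_
  rw [← Finset.sum_mul]
  simp only [fun x => sameMode_comm x y, sum_sameMode]

/-- The bound for cyclic products whose opposite coordinates share a mode. -/
def oppositeBound (d : Fin n ⊕ Fin n → ℝ) (x y w v : Fin n ⊕ Fin n) : ℝ :=
  d x * d y * (sameMode x w * d w) * d v

/-- The bound for cyclic products whose first two coordinates share a mode. -/
def adjacentBound (d : Fin n ⊕ Fin n → ℝ) (x y w v : Fin n ⊕ Fin n) : ℝ :=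
  d x * (sameMode x y * d y) * d w * d v
    + 12 * (sameMode x y * d w * d v + n * (sameMode x y * (d w * (sameMode w v * d v)))
      + n * (sameMode x y * (sameMode x w * d w) * d v)
      + n * (sameMode x y * d w * (sameMode x v * d v))
      + n ^ 2 * (sameMode x y * (sameMode x w * d w) * (sameMode x v * d v)))

section Sums

variable {d : Fin n ⊕ Fin n → ℝ} {Z S : ℝ}

theorem sum_sameMode_mul_le (hZ : ∀ x, d x ≤ Z) (x : Fin n ⊕ Fin n) :
    ∑ y, sameMode x y * d y ≤ 2 * Z := by
  rw [sum_sameMode_mul]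
  linarith [hZ (Sum.inl (mode x)), hZ (Sum.inr (mode x))]

theorem sum_mul_sameMode_le (hd : ∀ x, 0 ≤ d x) (hZ : ∀ x, d x ≤ Z) :
    ∑ x, d x * ∑ y, sameMode x y * d y ≤ 2 * Z * ∑ x, d x := by
  rw [Finset.mul_sum]
  refine Finset.sum_le_sum fun x _ => ?_
  rw [mul_comm]
  exact mul_le_mul_of_nonneg_right (sum_sameMode_mul_le hZ x) (hd x)

theorem sum_oppositeBound_le (hd : ∀ x, 0 ≤ d x) (hZ : ∀ x, d x ≤ Z) (hS : ∑ x, d x = S) :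
    ∑ x, ∑ y, ∑ w, ∑ v, oppositeBound d x y w v ≤ 2 * Z * S ^ 3 := by
  have hS0 : 0 ≤ S := hS ▸ Finset.sum_nonneg fun x _ => hd x
  have h := sum_mul_sameMode_le hd hZ
  rw [hS] at h
  calc _ = (∑ x, d x * ∑ w, sameMode x w * d w) * S * S := by
        simp only [oppositeBound, ← Finset.mul_sum, ← Finset.sum_mul, hS]
        rw [Finset.sum_mul, Finset.sum_mul, Finset.sum_mul]
        exact Finset.sum_congr rfl fun x _ => by ring
    _ ≤ (2 * Z * S) * S * S := by gcongr
    _ = _ := by ring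

theorem sum_adjacentBound_le (hd : ∀ x, 0 ≤ d x) (hZ : ∀ x, d x ≤ Z) (hS : ∑ x, d x = S) :
    ∑ x, ∑ y, ∑ w, ∑ v, adjacentBound d x y w v
      ≤ 2 * Z * S ^ 3 + 12 * (12 * n * S ^ 2 + 16 * n ^ 2 * Z * S) := by
  have hS0 : 0 ≤ S := hS ▸ Finset.sum_nonneg fun x _ => hd x
  have h := sum_mul_sameMode_le hd hZ
  have h2 := sum_sum_sameMode_mul d
  rw [hS] at h h2
  have hM : ∀ x, 0 ≤ ∑ y, sameMode x y * d y := fun x =>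
    Finset.sum_nonneg fun y _ => mul_nonneg (sameMode_nonneg x y) (hd y)
  have hMM : ∑ x, (∑ y, sameMode x y * d y) * (∑ y, sameMode x y * d y) ≤ 2 * Z * (2 * S) := by
    rw [← h2, Finset.mul_sum]
    exact Finset.sum_le_sum fun x _ =>
      mul_le_mul_of_nonneg_right (sum_sameMode_mul_le hZ x) (hM x)
  have hcard : ∀ c : ℝ, ∑ _x : Fin n ⊕ Fin n, c = 2 * n * c := fun c => by
    rw [Finset.sum_const, nsmul_eq_mul, Finset.card_univ, Fintype.card_sum, Fintype.card_fin]
    push_cast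
    ring
  have e1 : ∑ x, ∑ y, ∑ w, ∑ v, d x * (sameMode x y * d y) * d w * d v
      = (∑ x, d x * ∑ y, sameMode x y * d y) * S * S := by
    simp only [← Finset.mul_sum, ← Finset.sum_mul, hS]
  have e2 : ∑ x : Fin n ⊕ Fin n, ∑ y, ∑ w, ∑ v, sameMode x y * d w * d v = 4 * n * S * S := by
    simp only [← Finset.mul_sum, ← Finset.sum_mul, hS, sum_sameMode]
    rw [hcard]; ring
  have e3 : ∑ x : Fin n ⊕ Fin n, ∑ y, ∑ w, ∑ v, (n : ℝ) * (sameMode x y * (d w * (sameMode w v * d v)))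
      = n * (4 * n * ∑ w, d w * ∑ v, sameMode w v * d v) := by
    simp only [← Finset.mul_sum, ← Finset.sum_mul, sum_sameMode]
    rw [hcard]; ring
  have e4 : ∑ x, ∑ y, ∑ w, ∑ v, (n : ℝ) * (sameMode x y * (sameMode x w * d w) * d v)
      = n * (2 * (2 * S) * S) := by
    simp only [← Finset.mul_sum, ← Finset.sum_mul, hS, sum_sameMode, h2]
  have e5 : ∑ x, ∑ y, ∑ w, ∑ v, (n : ℝ) * (sameMode x y * d w * (sameMode x v * d v))
      = n * (2 * S * (2 * S)) := by
    simp only [← Finset.mul_sum, ← Finset.sum_mul, hS, sum_sameMode, h2]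
  have e6 : ∑ x, ∑ y, ∑ w, ∑ v,
      (n : ℝ) ^ 2 * (sameMode x y * (sameMode x w * d w) * (sameMode x v * d v))
      = n ^ 2 * (2 * ∑ x, (∑ y, sameMode x y * d y) * (∑ y, sameMode x y * d y)) := by
    simp only [← Finset.mul_sum, ← Finset.sum_mul, sum_sameMode]
    simp only [mul_assoc, ← Finset.mul_sum]
  have key : ∑ x, ∑ y, ∑ w, ∑ v, adjacentBound d x y w v
      = (∑ x, d x * ∑ y, sameMode x y * d y) * S * S
        + 12 * (4 * n * S * S + n * (4 * n * ∑ w, d w * ∑ v, sameMode w v * d v)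
          + n * (2 * (2 * S) * S) + n * (2 * S * (2 * S))
          + n ^ 2 * (2 * ∑ x, (∑ y, sameMode x y * d y) * (∑ y, sameMode x y * d y))) := by
    rw [← e1, ← e2, ← e3, ← e4, ← e5, ← e6]
    simp only [← Finset.sum_add_distrib, Finset.mul_sum]
    rfl
  rw [key]
  have a1 : (∑ x, d x * ∑ y, sameMode x y * d y) * S * S ≤ (2 * Z * S) * S * S := by gcongr
  have a2 : (n : ℝ) * (4 * n * ∑ w, d w * ∑ v, sameMode w v * d v)
      ≤ n * (4 * n * (2 * Z * S)) := by gcongr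
  have a3 : (n : ℝ) ^ 2 * (2 * ∑ x, (∑ y, sameMode x y * d y) * (∑ y, sameMode x y * d y))
      ≤ n ^ 2 * (2 * (2 * Z * (2 * S))) := by gcongr
  linarith

end Sums

/-! ### The error term -/

/-- The pointwise bound for the deviation of a weighted cyclic product from its leading value. -/
def deviationBound (d : Fin n ⊕ Fin n → ℝ) (x y w v : Fin n ⊕ Fin n) : ℝ :=
  78 / n * (d x * d y * d w * d v)
    + 49 * (oppositeBound d x y w v + oppositeBound d y w v x)
    + (adjacentBound d x y w v + adjacentBound d y w v x + adjacentBound d w v x y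
      + adjacentBound d v x y w)

theorem oppositeBound_nonneg {d : Fin n ⊕ Fin n → ℝ} (hd : ∀ x, 0 ≤ d x)
    (x y w v : Fin n ⊕ Fin n) : 0 ≤ oppositeBound d x y w v := by
  have := hd x; have := hd y; have := hd w; have := hd v
  have := sameMode_nonneg x w
  unfold oppositeBound
  positivity

theorem adjacentBound_nonneg {d : Fin n ⊕ Fin n → ℝ} (hd : ∀ x, 0 ≤ d x)
    (x y w v : Fin n ⊕ Fin n) : 0 ≤ adjacentBound d x y w v := by
  have := hd x; have := hd y; have := hd w; have := hd v
  have := sameMode_nonneg x y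
  have := sameMode_nonneg w v
  have := sameMode_nonneg x w
  have := sameMode_nonneg x v
  unfold adjacentBound
  positivity

theorem adjacent_deviation_le (hn : 4 ≤ n) (hk : 1 ≤ k) (hkn : k ≤ n) {z : Fin n → ℝ}
    (hz : ∀ j, 1 ≤ z j) {x y : Fin n ⊕ Fin n} (w v : Fin n ⊕ Fin n) (hm : mode x = mode y) :
    squeezeDiag z x * squeezeDiag z y * squeezeDiag z w * squeezeDiag z v *
      ((n : ℝ) ^ 4 * |cycleMean k x y w v - k / (8 * n ^ 4)|)
      ≤ (k : ℝ) ^ 2 * adjacentBound (squeezeDiag z) x y w v := by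
  have hd : ∀ x, 0 ≤ squeezeDiag z x := fun x => (squeezeDiag_pos hz x).le
  set d := squeezeDiag z with hdef
  have hn' : (4 : ℝ) ≤ n := by exact_mod_cast hn
  have hk' : (1 : ℝ) ≤ k := by exact_mod_cast hk
  have hxy : sameMode x y = 1 := if_pos hm
  have hdx := hd x
  have hdy := hd y
  have hdw := hd w
  have hdv := hd v
  have i1 := sameMode_nonneg w v
  have i2 := sameMode_nonneg x w
  have i3 := sameMode_nonneg x v
  have h1 : (n : ℝ) ^ 4 * |cycleMean k x y w v - k / (8 * n ^ 4)|
      ≤ (n : ℝ) ^ 4 * |cycleMean k x y w v| + (k : ℝ) ^ 2 := by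
    have : |cycleMean k x y w v - k / (8 * n ^ 4)|
        ≤ |cycleMean k x y w v| + k / (8 * (n : ℝ) ^ 4) := by
      refine (abs_sub _ _).trans ?_
      rw [abs_of_nonneg (by positivity : (0 : ℝ) ≤ k / (8 * (n : ℝ) ^ 4))]
    calc _ ≤ (n : ℝ) ^ 4 * (|cycleMean k x y w v| + k / (8 * (n : ℝ) ^ 4)) := by gcongr
      _ = (n : ℝ) ^ 4 * |cycleMean k x y w v| + k / 8 := by field_simp
      _ ≤ _ := by nlinarith
  have h2 : d x * d y * d w * d v * ((n : ℝ) ^ 4 * |cycleMean k x y w v|)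
      ≤ d w * d v * (12 * (k : ℝ) ^ 2 * (1 + n * sameMode w v + n * sameMode x w
        + n * sameMode x v + n ^ 2 * (sameMode x w * sameMode x v))) := by
    by_cases hne : x = y
    -- The weights of equal coordinates need not cancel, but the cyclic product vanishes. Only the
    -- subtracted constant remains, covered by the first term of `adjacentBound`.
    · subst hne
      rw [cycleMean_self]
      simp only [abs_zero, mul_zero]
      positivity
    · rw [squeezeDiag_mul_eq_one hz hm hne, one_mul]
      exact mul_le_mul_of_nonneg_left (abs_cycleMean_le_of_adjacent hn hk hkn w v hm hne)
        (by positivity)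
  calc _ ≤ d x * d y * d w * d v * ((n : ℝ) ^ 4 * |cycleMean k x y w v| + (k : ℝ) ^ 2) := by
        gcongr
    _ ≤ d w * d v * (12 * (k : ℝ) ^ 2 * (1 + n * sameMode w v + n * sameMode x w
        + n * sameMode x v + n ^ 2 * (sameMode x w * sameMode x v)))
        + d x * d y * d w * d v * (k : ℝ) ^ 2 := by rw [mul_add]; gcongr
    _ = _ := by rw [adjacentBound, hxy]; ring

theorem opposite_deviation_le (hn : 4 ≤ n) (hk : 1 ≤ k) (hkn : k ≤ n) {d : Fin n ⊕ Fin n → ℝ}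
    (hd : ∀ x, 0 ≤ d x) {x y w v : Fin n ⊕ Fin n} (hab : mode x ≠ mode y)
    (had : mode x ≠ mode v) (hac : mode x = mode w) :
    d x * d y * d w * d v * ((n : ℝ) ^ 4 * |cycleMean k x y w v - k / (8 * n ^ 4)|)
      ≤ (k : ℝ) ^ 2 * (49 * oppositeBound d x y w v) := by
  have h := abs_cycleMean_le_of_opposite hn hk hkn hab had hac
  have hn' : (4 : ℝ) ≤ n := by exact_mod_cast hn
  have hk' : (1 : ℝ) ≤ k := by exact_mod_cast hk
  have hxw : sameMode x w = 1 := if_pos hac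
  have hdx := hd x
  have hdy := hd y
  have hdw := hd w
  have hdv := hd v
  have h1 : (n : ℝ) ^ 4 * |cycleMean k x y w v - k / (8 * n ^ 4)| ≤ 49 * (k : ℝ) ^ 2 := by
    have : |cycleMean k x y w v - k / (8 * n ^ 4)|
        ≤ |cycleMean k x y w v| + k / (8 * (n : ℝ) ^ 4) := by
      refine (abs_sub _ _).trans ?_
      rw [abs_of_nonneg (by positivity : (0 : ℝ) ≤ k / (8 * (n : ℝ) ^ 4))]
    calc _ ≤ (n : ℝ) ^ 4 * (|cycleMean k x y w v| + k / (8 * (n : ℝ) ^ 4)) := by gcongr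
      _ = (n : ℝ) ^ 4 * |cycleMean k x y w v| + k / 8 := by field_simp
      _ ≤ _ := by nlinarith
  calc _ ≤ d x * d y * d w * d v * (49 * (k : ℝ) ^ 2) := by gcongr
    _ = _ := by rw [oppositeBound, hxw]; ring

theorem deviation_le (hn : 4 ≤ n) (hk : 1 ≤ k) (hkn : k ≤ n) {z : Fin n → ℝ}
    (hz : ∀ j, 1 ≤ z j) (x y w v : Fin n ⊕ Fin n) :
    squeezeDiag z x * squeezeDiag z y * squeezeDiag z w * squeezeDiag z v *
      ((n : ℝ) ^ 4 * |cycleMean k x y w v - k / (8 * n ^ 4)|)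
      ≤ (k : ℝ) ^ 2 * deviationBound (squeezeDiag z) x y w v := by
  have hd : ∀ x, 0 ≤ squeezeDiag z x := fun x => (squeezeDiag_pos hz x).le
  have hn' : (4 : ℝ) ≤ n := by exact_mod_cast hn
  have hk2 : (0 : ℝ) ≤ (k : ℝ) ^ 2 := by positivity
  have o1 := mul_nonneg hk2 (oppositeBound_nonneg hd x y w v)
  have o2 := mul_nonneg hk2 (oppositeBound_nonneg hd y w v x)
  have a1 := mul_nonneg hk2 (adjacentBound_nonneg hd x y w v)
  have a2 := mul_nonneg hk2 (adjacentBound_nonneg hd y w v x)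
  have a3 := mul_nonneg hk2 (adjacentBound_nonneg hd w v x y)
  have a4 := mul_nonneg hk2 (adjacentBound_nonneg hd v x y w)
  have m0 : 0 ≤ (k : ℝ) ^ 2 * (78 / n * (squeezeDiag z x * squeezeDiag z y * squeezeDiag z w
      * squeezeDiag z v)) := by
    have := hd x; have := hd y; have := hd w; have := hd v
    positivity
  unfold deviationBound
  -- Adjacent coincidences are removed first, since the opposite case assumes there are none.
  -- Rotating the cycle brings each case to standard position, and the unused summands of the bound
  -- are nonnegative.
  by_cases hab : mode x = mode y
  · have := adjacent_deviation_le hn hk hkn hz w v hab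
    linarith
  by_cases hbc : mode y = mode w
  · have := adjacent_deviation_le hn hk hkn hz v x hbc
    rw [← cycleMean_rotate] at this
    linarith
  by_cases hcd : mode w = mode v
  · have := adjacent_deviation_le hn hk hkn hz x y hcd
    rw [← cycleMean_rotate, ← cycleMean_rotate] at this
    linarith
  by_cases had : mode v = mode x
  · have := adjacent_deviation_le hn hk hkn hz y w had
    rw [cycleMean_rotate] at this
    linarith
  by_cases hac : mode x = mode w
  · have := opposite_deviation_le hn hk hkn hd hab (Ne.symm had) hac
    linarith
  by_cases hbd : mode y = mode v
  · have := opposite_deviation_le hn hk hkn hd hbc (Ne.symm hab) hbd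
    rw [← cycleMean_rotate] at this
    linarith
  have h := abs_cycleMean_sub_le hn hk hkn hab hac (Ne.symm had) hbc hbd hcd
  have h1 : (n : ℝ) ^ 4 * |cycleMean k x y w v - k / (8 * n ^ 4)| ≤ 78 / n * (k : ℝ) ^ 2 := by
    have e : (n : ℝ) ^ 5 * cycleMean k x y w v - n * k / 8
        = n ^ 5 * (cycleMean k x y w v - k / (8 * n ^ 4)) := by
      field_simp
    rw [e, abs_mul, abs_of_nonneg (by positivity)] at h
    rw [div_mul_eq_mul_div, le_div_iff₀ (by linarith)]
    linarith
  have hdx := hd x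
  have hdy := hd y
  have hdw := hd w
  have hdv := hd v
  have : squeezeDiag z x * squeezeDiag z y * squeezeDiag z w * squeezeDiag z v *
      ((n : ℝ) ^ 4 * |cycleMean k x y w v - k / (8 * n ^ 4)|)
      ≤ squeezeDiag z x * squeezeDiag z y * squeezeDiag z w * squeezeDiag z v *
        (78 / n * (k : ℝ) ^ 2) := by gcongr
  linarith

theorem sum_deviationBound_le {d : Fin n ⊕ Fin n → ℝ} {Z S : ℝ} (hd : ∀ x, 0 ≤ d x)
    (hZ : ∀ x, d x ≤ Z) (hS : ∑ x, d x = S) :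
    ∑ x, ∑ y, ∑ w, ∑ v, deviationBound d x y w v
      ≤ 78 / n * S ^ 4 + 204 * Z * S ^ 3 + 576 * n * S ^ 2 + 768 * n ^ 2 * Z * S := by
  have h1 := sum_oppositeBound_le hd hZ hS
  have h2 := sum_adjacentBound_le hd hZ hS
  have r1 := sum_rotate (oppositeBound d)
  have r2 := sum_rotate (adjacentBound d)
  have r3 := sum_rotate fun x y w v => adjacentBound d y w v x
  have r4 := sum_rotate fun x y w v => adjacentBound d w v x y
  have e : ∑ x, ∑ y, ∑ w, ∑ v, 78 / (n : ℝ) * (d x * d y * d w * d v) = 78 / n * S ^ 4 := by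
    simp only [← Finset.mul_sum, ← Finset.sum_mul, hS]
    ring
  have key : ∑ x, ∑ y, ∑ w, ∑ v, deviationBound d x y w v
      = 78 / n * S ^ 4 + 49 * ((∑ x, ∑ y, ∑ w, ∑ v, oppositeBound d x y w v)
          + ∑ x, ∑ y, ∑ w, ∑ v, oppositeBound d y w v x)
        + ((∑ x, ∑ y, ∑ w, ∑ v, adjacentBound d x y w v)
          + (∑ x, ∑ y, ∑ w, ∑ v, adjacentBound d y w v x)
          + (∑ x, ∑ y, ∑ w, ∑ v, adjacentBound d w v x y)
          + ∑ x, ∑ y, ∑ w, ∑ v, adjacentBound d v x y w) := by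
    rw [← e]
    simp only [← Finset.sum_add_distrib, Finset.mul_sum]
    rfl
  rw [key, r4, r3, r2, r1]
  linarith

/-- A nonasymptotic form of the fourth moment estimate. -/
theorem abs_fourthMoment_sub_le (hn : 4 ≤ n) (hk : 1 ≤ k) (hkn : k ≤ n) {z : Fin n → ℝ}
    (hz : ∀ j, 1 ≤ z j) {Z L : ℝ} (h1Z : 1 ≤ Z) (hZ : ∀ j, z j ≤ Z) (hL : avgEnergy z ≤ L) :
    |fourthMoment z k - 2 * k * avgEnergy z ^ 4|
      ≤ (1248 * L ^ 4 + 1632 * L ^ 3 + 2304 * L ^ 2 + 1536 * L) * ((k : ℝ) ^ 2 * Z / n) := by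
  have hd : ∀ x, 0 ≤ squeezeDiag z x := fun x => (squeezeDiag_pos hz x).le
  have hS := sum_squeezeDiag (by omega : n ≠ 0) z
  have hn0 : (0 : ℝ) < n := by exact_mod_cast (by omega : 0 < n)
  have hlam : 0 ≤ avgEnergy z := by
    have : 0 ≤ 2 * n * avgEnergy z := hS ▸ Finset.sum_nonneg fun x _ => hd x
    exact nonneg_of_mul_nonneg_right this (by positivity)
  have hL0 : 0 ≤ L := hlam.trans hL
  -- The main term is spread evenly over all quadruples, including those with coinciding modes.
  have hmain : (2 : ℝ) * k * avgEnergy z ^ 4 = ∑ x, ∑ y, ∑ w, ∑ v,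
      squeezeDiag z x * squeezeDiag z y * squeezeDiag z w * squeezeDiag z v * (k / (8 * n ^ 4)) := by
    simp only [← Finset.mul_sum, ← Finset.sum_mul, hS]
    field_simp
    ring
  have hdiff : fourthMoment z k - 2 * k * avgEnergy z ^ 4 = ∑ x, ∑ y, ∑ w, ∑ v,
      squeezeDiag z x * squeezeDiag z y * squeezeDiag z w * squeezeDiag z v *
        (cycleMean k x y w v - k / (8 * n ^ 4)) := by
    rw [fourthMoment_eq_sum, hmain]
    simp only [← Finset.sum_sub_distrib, ← mul_sub]
  have hbound : (n : ℝ) ^ 4 * |fourthMoment z k - 2 * k * avgEnergy z ^ 4|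
      ≤ (k : ℝ) ^ 2 * ∑ x, ∑ y, ∑ w, ∑ v, deviationBound (squeezeDiag z) x y w v := by
    rw [hdiff, Finset.mul_sum]
    refine (mul_le_mul_of_nonneg_left (Finset.abs_sum_le_sum_abs _ _) (by positivity)).trans ?_
    rw [Finset.mul_sum]
    refine Finset.sum_le_sum fun x _ => ?_
    rw [Finset.mul_sum]
    refine (mul_le_mul_of_nonneg_left (Finset.abs_sum_le_sum_abs _ _) (by positivity)).trans ?_
    rw [Finset.mul_sum]
    refine Finset.sum_le_sum fun y _ => ?_
    rw [Finset.mul_sum]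
    refine (mul_le_mul_of_nonneg_left (Finset.abs_sum_le_sum_abs _ _) (by positivity)).trans ?_
    rw [Finset.mul_sum]
    refine Finset.sum_le_sum fun w _ => ?_
    rw [Finset.mul_sum]
    refine (mul_le_mul_of_nonneg_left (Finset.abs_sum_le_sum_abs _ _) (by positivity)).trans ?_
    rw [Finset.mul_sum]
    refine Finset.sum_le_sum fun v _ => ?_
    refine le_trans (le_of_eq ?_) (deviation_le hn hk hkn hz x y w v)
    have hdx := hd x
    have hdy := hd y
    have hdw := hd w
    have hdv := hd v
    rw [abs_mul, abs_of_nonneg (by positivity : 0 ≤ squeezeDiag z x * squeezeDiag z y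
      * squeezeDiag z w * squeezeDiag z v)]
    ring
  have hsum := sum_deviationBound_le hd (squeezeDiag_le hz h1Z hZ) hS
  set lam := avgEnergy z
  have hZ0 : 0 ≤ Z := zero_le_one.trans h1Z
  have hsum2 : 78 / n * (2 * n * lam) ^ 4 + 204 * Z * (2 * n * lam) ^ 3
      + 576 * n * (2 * n * lam) ^ 2 + 768 * n ^ 2 * Z * (2 * n * lam)
      ≤ (1248 * L ^ 4 + 1632 * L ^ 3 + 2304 * L ^ 2 + 1536 * L) * (n ^ 3 * Z) := by
    calc _ = 1248 * lam ^ 4 * (n ^ 3 * 1) + 1632 * lam ^ 3 * (n ^ 3 * Z)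
          + 2304 * lam ^ 2 * (n ^ 3 * 1) + 1536 * lam * (n ^ 3 * Z) := by field_simp; ring
      _ ≤ 1248 * L ^ 4 * (n ^ 3 * Z) + 1632 * L ^ 3 * (n ^ 3 * Z)
          + 2304 * L ^ 2 * (n ^ 3 * Z) + 1536 * L * (n ^ 3 * Z) := by gcongr
      _ = _ := by ring
  have h4 : (n : ℝ) ^ 4 * |fourthMoment z k - 2 * k * lam ^ 4| ≤ (n : ℝ) ^ 4 *
      ((1248 * L ^ 4 + 1632 * L ^ 3 + 2304 * L ^ 2 + 1536 * L) * ((k : ℝ) ^ 2 * Z / n)) := by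
    refine (hbound.trans (mul_le_mul_of_nonneg_left (hsum.trans hsum2) (by positivity))).trans_eq ?_
    field_simp
  exact le_of_mul_le_mul_left h4 (by positivity)

open scoped Matrix.Norms.L2Operator in
theorem le_norm_diagonal (z : Fin n → ℝ) (j : Fin n) : z j ≤ ‖Matrix.diagonal z‖ := by
  rw [Matrix.l2_opNorm_diagonal]
  exact (le_abs_self _).trans (norm_le_pi_norm z j)

end GaussianMoments

end

theorem lemma3p1 (ζ κ : ℝ) (hζ₀ : 0 ≤ ζ) (hζ₁ : ζ < 1) (hκ₀ : 0 ≤ κ) (hκ₁ : κ < 1)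
    (z : ∀ n : ℕ, Fin n → ℝ) (hz : GaussianMoments.BoundedSqueezing ζ z)
    (hE : ∃ L : ℝ, ∀ n : ℕ, GaussianMoments.avgEnergy (z n) ≤ L)
    (k : ℕ → ℕ) (hk : GaussianMoments.BoundedSubsystem κ k) :
    (fun n : ℕ => GaussianMoments.fourthMoment (z n) (k n)
        - 2 * (k n : ℝ) * GaussianMoments.avgEnergy (z n) ^ 4)
      =O[atTop] fun n : ℕ => (n : ℝ) ^ (2 * κ + ζ - 1) := by
  obtain ⟨hz1, C, hC, hzC⟩ := hz
  obtain ⟨hk1, K, hK, hkK⟩ := hk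
  obtain ⟨L₀, hL₀⟩ := hE
  -- Truncation at `0` makes the constant `B` nonnegative without information on the sign of `L₀`.
  set L := max L₀ 0 with hLdef
  have hL0 : 0 ≤ L := le_max_right _ _
  set B := 1248 * L ^ 4 + 1632 * L ^ 3 + 2304 * L ^ 2 + 1536 * L with hB
  have hB0 : 0 ≤ B := by positivity
  refine IsBigO.of_bound (B * (K ^ 2 * (C + 1))) ?_
  filter_upwards [hzC, hkK, eventually_ge_atTop 4] with n hzn hkn hn
  have hn1 : (1 : ℝ) ≤ n := by exact_mod_cast (by omega : 1 ≤ n)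
  have hn0 : (0 : ℝ) < n := zero_lt_one.trans_le hn1
  have hζ1 : (1 : ℝ) ≤ (n : ℝ) ^ ζ := Real.one_le_rpow hn1 hζ₀
  -- Taking `C + 1` instead of `C` ensures `1 ≤ Z` even if `C` is small.
  have hmain := GaussianMoments.abs_fourthMoment_sub_le hn (hk1 n (by omega)).1
    (hk1 n (by omega)).2 (hz1 n) (Z := (C + 1) * (n : ℝ) ^ ζ) (L := L)
    (by nlinarith) (fun j => (GaussianMoments.le_norm_diagonal (z n) j).trans
      (hzn.trans (by nlinarith))) ((hL₀ n).trans (le_max_left _ _))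
  rw [Real.norm_eq_abs, Real.norm_of_nonneg (by positivity)]
  refine hmain.trans ?_
  rw [← hB, mul_assoc B]
  refine mul_le_mul_of_nonneg_left ?_ hB0
  have hpow : (n : ℝ) ^ (2 * κ + ζ - 1) = ((n : ℝ) ^ κ) ^ 2 * (n : ℝ) ^ ζ / n := by
    rw [Real.rpow_sub_one hn0.ne', Real.rpow_add hn0, mul_comm 2 κ, Real.rpow_mul hn0.le,
      Real.rpow_two]
  rw [hpow]
  calc ((k n : ℝ)) ^ 2 * ((C + 1) * (n : ℝ) ^ ζ) / n
      ≤ (K * (n : ℝ) ^ κ) ^ 2 * ((C + 1) * (n : ℝ) ^ ζ) / n := by gcongr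
    _ = _ := by ring
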